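/- Let $n\ge 1$ and let $\langle\zeta,\eta\rangle=\sum_\ell \zeta_\ell\bar\eta_\ell$ be the standard hermitian product of $\mathbb C^n\simeq\mathbb R^{2n}$. Let $A\in\mathcal S^2(\mathbb C^n)$, i.e. let $A\subset\mathbb C^n$ be a connected compact set with non-empty interior whose boundary $\partial A$ is a closed real hypersurface of class $\mathcal C^2$. Let $\nu=\nabla\rho/\Vert\nabla\rho\Vert$ be its Gauss map (the outward unit normal), where $\rho$ is any $\mathcal C^2$ defining function of $A$ ($\rho<0$ on the interior of $A$, $\rho=0$ and $\mathrm d\rho\ne0$ on $\partial A$, $\rho>0$ outside $A$). Orient $\partial A$ as the boundary of $A$ (outward normal first, $\mathbb C^n$ being oriented by $\mathrm dx_1\wedge\mathrm dy_1\wedge\dots\wedge\mathrm dx_n\wedge\mathrm dy_n$), and let $\upsilon_{\partial A}$ be its volume form, the restriction to $\partial A$ of the contraction of this form with $\nu$. Let $\alpha_{\partial A}$ be the $1$-form on $\partial A$ given by $(\alpha_{\partial A})_z(\zeta)=\mathrm{Re}\,\langle\zeta,i\nu(z)\rangle$ for $\zeta\in T_z\partial A$. The Kazarnovskii pseudovolume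 of $A$ is $$P_n(A)=\frac{1}{n!\,\varkappa_n}\int_{\partial A}\alpha_{\partial A}\wedge(\mathrm d\alpha_{\partial A})^{\wedge(n-1)},$$ where $\varkappa_n$ is the volume of the unit ball of $\mathbb R^n$. For $z\in\partial A$ let $T_z^{\mathbb C}\partial A$ be the maximal complex subspace of $T_z\partial A$, let $\mathit{II}_z(\zeta,\eta)=\mathrm{Re}\,\langle \mathrm d\nu_z(\zeta),\eta\rangle$ for $\zeta,\eta\in T_z\partial A$, and for $\zeta,\eta\in T_z^{\mathbb C}\partial A$ let $\mathit{II}^{\mathbb C}_z(\zeta,\eta)=\tfrac12\big(\mathit{II}_z(\zeta,\eta)+\mathit{II}_z(i\zeta,i\eta)\big)$. The Levi form of $\partial A$ at $z$ is the hermitian form $\mathcal L_{\partial A,z}(\zeta,\eta)=\mathit{II}^{\mathbb C}_z(\zeta,\eta)+i\,\mathit{II}^{\mathbb C}_z(\zeta,i\eta)$ on $T_z^{\mathbb C}\partial A$. Let $K_{\partial A}(z)$ be its determinant, i.e. the product of its $n-1$ eigenvalues with respect to $\langle\,,\rangle$ (so $K_{\partial A}=1$ if $n=1$). Then the forms $\alpha_{\partial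 A}\wedge(\mathrm d\alpha_{\partial A})^{\wedge(n-1)}$ and $K_{\partial A}\,\upsilon_{\partial A}$ are integrable on $\partial A$, and $$P_n(A)=\frac{2^{n-1}(n-1)!}{n!\,\varkappa_n}\int_{\partial A}K_{\partial A}\,\upsilon_{\partial A}.$$ In particular, if $A$ is (Levi) pseudoconvex, i.e. $\mathcal L_{\partial A,z}(\zeta,\zeta)\ge 0$ for every $z\in\partial A$ and every $\zeta\in T_z^{\mathbb C}\partial A$, then $P_n(A)\ge 0$. -/

import Mathlib

open MeasureTheory Topology

noncomputable section

namespace Pseudovolume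

/-- The space `ℂⁿ` with its standard hermitian product. -/
abbrev Cn (n : ℕ) : Type := EuclideanSpace ℂ (Fin n)

/-- The Euclidean scalar product `Re ⟨v, w⟩` of `ℂⁿ = ℝ²ⁿ`. -/
def reInner {n : ℕ} (v w : Cn n) : ℝ := (inner ℂ v w).re

/-! ### Regular compact sets -/

/-- `M` is a (real) hypersurface of class `C^k` of `ℂⁿ`: near each of its points it is the zero set
of a real function of class `C^k` without critical points. -/
def IsHypersurface {n : ℕ} (k : ℕ) (M : Set (Cn n)) : Prop :=
  ∀ p ∈ M, ∃ U : Set (Cn n), IsOpen U ∧ p ∈ U ∧ ∃ f : Cn n → ℝ,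
    ContDiffOn ℝ k f U ∧ (∀ z ∈ U, fderiv ℝ f z ≠ 0) ∧ M ∩ U = {z ∈ U | f z = 0}

/-- The class `𝒮ᵏ(ℂⁿ)`: connected compact sets with non-empty interior whose boundary is a closed
hypersurface of class `C^k`. -/
structure IsRegular {n : ℕ} (k : ℕ) (A : Set (Cn n)) : Prop where
  isCompact : IsCompact A
  isConnected : IsConnected A
  interior_nonempty : (interior A).Nonempty
  isHypersurface_frontier : IsHypersurface k (frontier A)

/-! ### The Gauss map -/

/-- The Euclidean gradient `(∂ρ/∂x₁ + i ∂ρ/∂y₁, …, ∂ρ/∂xₙ + i ∂ρ/∂yₙ)` of `ρ : ℂⁿ → ℝ`. -/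
def grad {n : ℕ} (ρ : Cn n → ℝ) (z : Cn n) : Cn n :=
  WithLp.toLp 2 fun j =>
    ⟨fderiv ℝ ρ z (EuclideanSpace.single j 1), fderiv ℝ ρ z (EuclideanSpace.single j Complex.I)⟩

/-- `ρ` is a defining function of class `C²` of the set `A` near the point `z`. -/
structure IsDefiningFunctionAt {n : ℕ} (A : Set (Cn n)) (z : Cn n) (ρ : Cn n → ℝ) : Prop where
  contDiffAt : ContDiffAt ℝ 2 ρ z
  grad_ne_zero : grad ρ z ≠ 0
  neg_of_mem_interior : ∀ᶠ w in 𝓝 z, w ∈ interior A → ρ w < 0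
  eq_zero_of_mem_frontier : ∀ᶠ w in 𝓝 z, w ∈ frontier A → ρ w = 0
  pos_of_notMem : ∀ᶠ w in 𝓝 z, w ∉ A → 0 < ρ w

open Classical in
/-- The Gauss map `ν = ∇ρ / ‖∇ρ‖` of `∂A`, that is, the outward unit normal; the value does not
depend on the defining function `ρ`. It is only meaningful on `∂A`. -/
def gaussMap {n : ℕ} (A : Set (Cn n)) (z : Cn n) : Cn n :=
  if h : ∃ ρ : Cn n → ℝ, IsDefiningFunctionAt A z ρ then
    (‖grad h.choose z‖⁻¹ : ℝ) • grad h.choose z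
  else 0

/-- The tangent hyperplane `T_z ∂A`, the real orthogonal complement of the normal. -/
def tangentHyperplane {n : ℕ} (A : Set (Cn n)) (z : Cn n) : Set (Cn n) :=
  {ζ | reInner (gaussMap A z) ζ = 0}

/-- The maximal complex subspace of `T_z ∂A`, the hermitian orthogonal complement of the normal. -/
def complexTangentSpace {n : ℕ} (A : Set (Cn n)) (z : Cn n) : Submodule ℂ (Cn n) :=
  (Submodule.span ℂ {gaussMap A z})ᗮ

theorem mem_complexTangentSpace_iff {n : ℕ} (A : Set (Cn n)) (z ζ : Cn n) :
    ζ ∈ complexTangentSpace A z ↔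
      ζ ∈ tangentHyperplane A z ∧ Complex.I • ζ ∈ tangentHyperplane A z := by
  rw [complexTangentSpace, Submodule.mem_orthogonal_singleton_iff_inner_right]
  simp [tangentHyperplane, reInner, Complex.ext_iff]

/-! ### Exterior algebra -/

/-- The wedge product of two alternating forms, normalised so that
`(a ∧ b)(v, w) = a(v) b(w) - a(w) b(v)` for 1-forms. -/
def wedge {V : Type*} [AddCommGroup V] [Module ℝ V] {p q : ℕ}
    (a : V [⋀^Fin p]→ₗ[ℝ] ℝ) (b : V [⋀^Fin q]→ₗ[ℝ] ℝ) : V [⋀^Fin (p + q)]→ₗ[ℝ] ℝ :=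
  ((LinearMap.mul' ℝ ℝ).compAlternatingMap (a.domCoprod b)).domDomCongr finSumFinEquiv

/-- The wedge power `b ∧ ⋯ ∧ b` (`k` factors) of a 2-form. -/
def wedgePow {V : Type*} [AddCommGroup V] [Module ℝ V] (b : V [⋀^Fin 2]→ₗ[ℝ] ℝ) :
    (k : ℕ) → V [⋀^Fin (2 * k)]→ₗ[ℝ] ℝ
  | 0 => AlternatingMap.constOfIsEmpty ℝ V (Fin 0) 1
  | k + 1 => wedge (wedgePow b k) b

/-- The real coordinates `(x₁, y₁, …, xₙ, yₙ)` of `ℂⁿ`. -/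
def realCoords (n : ℕ) : Cn n →ₗ[ℝ] (Fin (2 * n) → ℝ) where
  toFun v k :=
    if k.1 % 2 = 0 then (v ⟨k.1 / 2, by omega⟩).re else (v ⟨k.1 / 2, by omega⟩).im
  map_add' v w := by
    ext k
    by_cases h : k.1 % 2 = 0 <;> simp [h]
  map_smul' c v := by
    ext k
    by_cases h : k.1 % 2 = 0 <;> simp [h]

/-- The standard volume form `dx₁ ∧ dy₁ ∧ ⋯ ∧ dxₙ ∧ dyₙ` of `ℂⁿ`. -/
def volForm (n : ℕ) : Cn n [⋀^Fin (2 * n)]→ₗ[ℝ] ℝ :=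
  Matrix.detRowAlternating.compLinearMap (realCoords n)

theorem two_mul_eq (n : ℕ) [NeZero n] : 2 * n = 1 + 2 * (n - 1) + 1 := by
  have := NeZero.pos n
  omega

/-! ### Integration of `(2n-1)`-forms on `∂A` -/

/-- The volume form `υ` of `∂A` at `z`: the contraction of the standard volume form of `ℂⁿ`
with the outward unit normal. -/
def boundaryVolForm {n : ℕ} [NeZero n] (A : Set (Cn n)) (z : Cn n) :
    Cn n [⋀^Fin (1 + 2 * (n - 1))]→ₗ[ℝ] ℝ :=
  ((volForm n).domDomCongr (finCongr (two_mul_eq n))).curryLeft (gaussMap A z)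

/-- `e` is a positively oriented orthonormal basis of `T_z ∂A`, for the boundary orientation
(outward normal first). -/
structure IsPositiveFrame {n : ℕ} [NeZero n] (A : Set (Cn n)) (z : Cn n)
    (e : Fin (1 + 2 * (n - 1)) → Cn n) : Prop where
  mem_tangent : ∀ j, e j ∈ tangentHyperplane A z
  orthonormal : ∀ j k, reInner (e j) (e k) = if j = k then 1 else 0
  pos : 0 < boundaryVolForm A z e

open Classical in
/-- The density of a form of top degree on `T_z ∂A` with respect to the Riemannian volume: its
value on a positively oriented orthonormal basis (it does not depend on the basis). -/
def formDensity {n : ℕ} [NeZero n] (A : Set (Cn n)) (z : Cn n)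
    (ω : Cn n [⋀^Fin (1 + 2 * (n - 1))]→ₗ[ℝ] ℝ) : ℝ :=
  if h : ∃ e, IsPositiveFrame A z e then ω h.choose else 0

/-- The `(2n-1)`-form `ω` is integrable on the oriented hypersurface `∂A`. -/
def FormIntegrable {n : ℕ} [NeZero n] (A : Set (Cn n))
    (ω : Cn n → Cn n [⋀^Fin (1 + 2 * (n - 1))]→ₗ[ℝ] ℝ) : Prop :=
  IntegrableOn (fun z => formDensity A z (ω z)) (frontier A) μHE[2 * n - 1]

/-- The integral `∫_{∂A} ω` of a `(2n-1)`-form on the oriented hypersurface `∂A`; the Riemannian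
volume measure of `∂A` is the Euclidean Hausdorff measure of dimension `2n-1`. -/
def formIntegral {n : ℕ} [NeZero n] (A : Set (Cn n))
    (ω : Cn n → Cn n [⋀^Fin (1 + 2 * (n - 1))]→ₗ[ℝ] ℝ) : ℝ :=
  ∫ z in frontier A, formDensity A z (ω z) ∂μHE[2 * n - 1]

/-! ### The pseudovolume -/

/-- The 1-form `α`, `α_z(ζ) = Re ⟨ζ, i ν(z)⟩`. -/
def alpha {n : ℕ} (A : Set (Cn n)) (z : Cn n) : Cn n [⋀^Fin 1]→L[ℝ] ℝ :=
  ContinuousAlternatingMap.ofSubsingleton ℝ (Cn n) ℝ (0 : Fin 1)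
    (Complex.reCLM.comp ((innerSL ℂ (Complex.I • gaussMap A z)).restrictScalars ℝ))

/-- The exterior derivative `dα` along `∂A`. Only its values on vectors of `T_z ∂A` are meaningful
(there they are the values of the exterior derivative of any `C¹` extension of `α` to a
neighbourhood of `z`), and only these are used. -/
def dAlpha {n : ℕ} (A : Set (Cn n)) (z : Cn n) : Cn n [⋀^Fin 2]→L[ℝ] ℝ :=
  extDerivWithin (alpha A) (frontier A) z

/-- The `(2n-1)`-form `α ∧ (dα)^{∧(n-1)}` on `∂A`. -/
def alphaWedge {n : ℕ} (A : Set (Cn n)) (z : Cn n) :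
    Cn n [⋀^Fin (1 + 2 * (n - 1))]→ₗ[ℝ] ℝ :=
  wedge (alpha A z).toAlternatingMap (wedgePow (dAlpha A z).toAlternatingMap (n - 1))

/-- The volume of the unit ball of `ℝⁿ`. -/
def ballVolume (n : ℕ) : ℝ :=
  (volume (Metric.closedBall (0 : EuclideanSpace ℝ (Fin n)) 1)).toReal

/-- The Kazarnovskii pseudovolume `P_n(A)`. -/
def pseudovolume {n : ℕ} [NeZero n] (A : Set (Cn n)) : ℝ :=
  1 / ((n.factorial : ℝ) * ballVolume n) * formIntegral A (alphaWedge A)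

/-! ### The Levi form -/

/-- The second quadratic form `II_z(ζ, η) = Re ⟨dν_z(ζ), η⟩` of `∂A`, for `ζ, η ∈ T_z ∂A`; here
`dν` is the derivative along `∂A`, which is determined on tangent vectors. -/
def secondForm {n : ℕ} (A : Set (Cn n)) (z ζ η : Cn n) : ℝ :=
  reInner (fderivWithin ℝ (gaussMap A) (frontier A) z ζ) η

/-- The form `II^ℂ_z(ζ, η) = (II_z(ζ, η) + II_z(iζ, iη)) / 2`, for complex tangent vectors. -/
def secondFormC {n : ℕ} (A : Set (Cn n)) (z ζ η : Cn n) : ℝ :=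
  (1 / 2) * (secondForm A z ζ η + secondForm A z (Complex.I • ζ) (Complex.I • η))

/-- The Levi form `ℒ_z(ζ, η) = II^ℂ_z(ζ, η) + i II^ℂ_z(ζ, iη)` of `∂A`, for complex tangent
vectors; it is linear in `ζ` and antilinear in `η`. -/
def leviForm {n : ℕ} (A : Set (Cn n)) (z ζ η : Cn n) : ℂ :=
  secondFormC A z ζ η + Complex.I * secondFormC A z ζ (Complex.I • η)

/-- The matrix of the Levi form in an orthonormal basis of the complex tangent space. -/
def leviMatrix {n : ℕ} (A : Set (Cn n)) (z : Cn n) :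
    Matrix (Fin (Module.finrank ℂ (complexTangentSpace A z)))
      (Fin (Module.finrank ℂ (complexTangentSpace A z))) ℂ :=
  Matrix.of fun j k =>
    leviForm A z (stdOrthonormalBasis ℂ (complexTangentSpace A z) j : Cn n)
      (stdOrthonormalBasis ℂ (complexTangentSpace A z) k : Cn n)

/-- The determinant `K(z)` of the Levi form, i.e. the product of its eigenvalues with respect to
the hermitian product of the complex tangent space (equal to `1` if `n = 1`). It is real because
the Levi form is hermitian. -/
def leviDet {n : ℕ} (A : Set (Cn n)) (z : Cn n) : ℝ :=
  (leviMatrix A z).det.re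

/-- Levi pseudoconvexity: the Levi form is positive semidefinite at all points of `∂A`. -/
def IsPseudoconvex {n : ℕ} (A : Set (Cn n)) : Prop :=
  ∀ z ∈ frontier A, ∀ ζ ∈ complexTangentSpace A z, 0 ≤ (leviForm A z ζ ζ).re

end Pseudovolume

end

/-! The two integrands agree pointwise up to the constant `2^(n-1) (n-1)!`, so the theorem is linear
algebra at each boundary point, together with enough regularity to integrate.

Put `n = m + 1` and complete `u₀ = ν(z)` to a unitary basis `u₀, …, u_m`. Then `iν, u₁, iu₁, …, u_m,
iu_m` is a positive orthonormal frame of `T_z ∂A`, and the density of a form is its value on this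
frame (`formDensity_eq`). Since `α(iν) = 1` and `α` vanishes on the complex tangent space, only
`(dα)^m` on `u₁, iu₁, …` remains. There `dα(ζ, η) = II(η, iζ) - II(ζ, iη)` (`dAlpha_apply`), which
by symmetry of `II` equals `i (ℒ(ζ, η) - ℒ(η, ζ))`. The top wedge power of the 2-form attached in
this way to a hermitian matrix is `2^m m!` times its determinant (`wedgePow_of_hermitian`, by
expanding a Pfaffian sum). This gives `formDensity_alphaWedge`.

For `dν` to make sense, `∂A` needs defining functions near each of its points
(`IsRegular.exists_isDefiningFunctionOn`), a Gauss map independent of their choice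
(`normalize_grad_eq`), and a tangent cone filling the tangent hyperplane, so that derivatives along
`∂A` are determined there.

Integrability holds because `∂A` is compact of finite measure and the Levi determinant is continuous
on it; continuity comes from a formula free of any choice of basis (`leviDet_eq_det`). In the
pseudoconvex case the Levi matrix is positive semidefinite, so its determinant is nonnegative. -/

noncomputable section

namespace Pseudovolume

/-! ### Evaluation of wedge powers -/

section Algebra

open Equiv

variable {V : Type*} [AddCommGroup V] [Module ℝ V]

/-- The multilinear map `(v₀, v₁, …) ↦ b(v₀, v₁) b(v₂, v₃) ⋯`. -/
def pairProd (b : V [⋀^Fin 2]→ₗ[ℝ] ℝ) : (k : ℕ) → MultilinearMap ℝ (fun _ : Fin (2 * k) => V) ℝ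
  | 0 => MultilinearMap.constOfIsEmpty ℝ (fun _ : Fin 0 => V) 1
  | k + 1 => ((LinearMap.mul' ℝ ℝ).compMultilinearMap
      (MultilinearMap.domCoprod (pairProd b k) b.toMultilinearMap)).domDomCongr finSumFinEquiv

theorem pairProd_apply (b : V [⋀^Fin 2]→ₗ[ℝ] ℝ) (k : ℕ) (v : Fin (2 * k) → V) :
    pairProd b k v =
      ∏ j : Fin k, b ![v ⟨2 * j, by omega⟩, v ⟨2 * j + 1, by omega⟩] := by
  induction k with
  | zero => simp [pairProd]
  | succ k ih =>
    rw [Fin.prod_univ_castSucc]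
    simp only [pairProd, MultilinearMap.domDomCongr_apply, LinearMap.compMultilinearMap_apply,
      MultilinearMap.domCoprod_apply, LinearMap.mul'_apply]
    rw [ih]
    congr 1
    change b _ = b _
    congr 1
    ext i
    fin_cases i <;> rfl

/-- Alternatization turns a tensor product into the shuffle product of the alternatizations, and
each factor `b`, already alternating, contributes `2! = 2`. -/
theorem alternatization_pairProd (b : V [⋀^Fin 2]→ₗ[ℝ] ℝ) (k : ℕ) :
    MultilinearMap.alternatization (pairProd b k) = (2 ^ k : ℝ) • wedgePow b k := by
  induction k with
  | zero =>
    ext v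
    simp [pairProd, wedgePow, MultilinearMap.alternatization_apply]
  | succ k ih =>
    have hb : MultilinearMap.alternatization b.toMultilinearMap = (2 : ℝ) • b := by
      have := AlternatingMap.coe_alternatization b
      simp only [Fintype.card_fin, Nat.factorial_two] at this
      rw [this]
      ext v
      simp [two_mul]
    have key : MultilinearMap.alternatization
        (MultilinearMap.domCoprod (pairProd b k) b.toMultilinearMap) =
        (2 ^ (k + 1) : ℝ) • (wedgePow b k).domCoprod b := by
      rw [MultilinearMap.domCoprod_alternization, ih, hb, ← AlternatingMap.domCoprod'_apply,
        ← AlternatingMap.domCoprod'_apply, ← TensorProduct.smul_tmul', TensorProduct.tmul_smul,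
        map_smul, map_smul, smul_smul, pow_succ]
    ext v
    have key2 := congrArg (fun F => LinearMap.mul' ℝ ℝ (F (v ∘ finSumFinEquiv))) key
    simp only [pairProd, wedgePow, wedge]
    simp only [AlternatingMap.smul_apply, map_smul] at key2 ⊢
    refine Eq.trans ?_ key2
    simp only [MultilinearMap.alternatization_apply, map_sum]
    refine Fintype.sum_equiv (finSumFinEquiv.permCongr.symm) _ _ fun σ => ?_
    simp only [Units.smul_def, map_zsmul, MultilinearMap.domDomCongr_apply,
      LinearMap.compMultilinearMap_apply]
    simp
    rfl

theorem two_pow_mul_wedgePow (b : V [⋀^Fin 2]→ₗ[ℝ] ℝ) (k : ℕ) (v : Fin (2 * k) → V) :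
    2 ^ k * wedgePow b k v = ∑ σ : Perm (Fin (2 * k)), ((Perm.sign σ : ℤ) : ℝ) *
      ∏ j : Fin k, b ![v (σ ⟨2 * j, by omega⟩), v (σ ⟨2 * j + 1, by omega⟩)] := by
  have := congrArg (fun F => F v) (alternatization_pairProd b k)
  simp only [AlternatingMap.smul_apply, smul_eq_mul] at this
  rw [← this, MultilinearMap.alternatization_apply]
  refine Finset.sum_congr rfl fun σ _ => ?_
  simp [MultilinearMap.domDomCongr_apply, pairProd_apply, Units.smul_def]

/-- In the sum over shuffles, every coset but the trivial one feeds some `v (Fin.natAdd 1 j)` to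
`a`, and so vanishes. -/
theorem wedge_apply_of_eq_zero {p : ℕ} (a : V [⋀^Fin 1]→ₗ[ℝ] ℝ) (β : V [⋀^Fin p]→ₗ[ℝ] ℝ)
    (v : Fin (1 + p) → V) (h : ∀ j : Fin p, a (fun _ => v (Fin.natAdd 1 j)) = 0) :
    wedge a β v = a (fun _ => v (Fin.castAdd p 0)) * β (fun j => v (Fin.natAdd 1 j)) := by
  simp only [wedge, AlternatingMap.domDomCongr_apply, LinearMap.compAlternatingMap_apply,
    AlternatingMap.domCoprod_apply, sum_apply, map_sum]
  refine (Finset.sum_eq_single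
    (Quotient.mk'' (1 : Perm (Fin 1 ⊕ Fin p)) : Perm.ModSumCongr (Fin 1) (Fin p)) ?_ ?_).trans ?_
  rotate_left 2
  · rw [AlternatingMap.domCoprod.summand_mk'']
    simp only [Perm.sign_one, one_smul, MultilinearMap.domDomCongr_apply,
      MultilinearMap.domCoprod_apply, LinearMap.mul'_apply]
    refine congrArg₂ (· * ·) (congrArg a (funext fun i => ?_)) rfl
    rw [Subsingleton.elim i 0]
    rfl
  · intro q _ hq
    induction q using Quotient.inductionOn' with | _ σ
    rw [AlternatingMap.domCoprod.summand_mk'']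
    rcases hσ : σ (Sum.inl 0) with i | j
    · exfalso
      apply hq
      refine (Quotient.eq''.mpr ?_).symm
      rw [QuotientGroup.leftRel_apply]
      simp only [inv_one, one_mul]
      apply Perm.mem_sumCongrHom_range_of_perm_mapsTo_inl
      rintro _ ⟨i', rfl⟩
      rw [Subsingleton.elim i' 0, hσ]
      exact ⟨i, rfl⟩
    · have h0 : (fun i : Fin 1 => v (finSumFinEquiv (σ (Sum.inl i)))) =
          fun _ => v (Fin.natAdd 1 j) := by
        ext i
        rw [Subsingleton.elim i 0, hσ]
        rfl
      simp [MultilinearMap.domDomCongr_apply, MultilinearMap.domCoprod_apply, h0, h,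
        Function.comp_def]
  · simp

end Algebra

/-! ### Pfaffian sums and determinants -/

section Pfaffian

open Equiv

variable {κ : Type*} [Fintype κ] [DecidableEq κ]

/-- The alternating sum over all permutations of `κ × {0, 1}` of the products of the values of
`B` on the pairs; for alternating `B` this is a multiple of the Pfaffian. -/
def pfaffianSum {R : Type*} [CommRing R] (B : κ × Fin 2 → κ × Fin 2 → R) : R :=
  ∑ σ : Perm (κ × Fin 2), ((Perm.sign σ : ℤ) : R) * ∏ j, B (σ (j, 0)) (σ (j, 1))

/-- Each difference is a signed sum over the permutations of `Fin 2`. A choice `τ` of one flip per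
pair is absorbed by the translation `σ ↦ σ τ`, so all `2^|κ|` choices contribute equally. -/
theorem pfaffianSum_sub_swap {R : Type*} [CommRing R] (C : κ × Fin 2 → κ × Fin 2 → R) :
    pfaffianSum (fun a a' => C a a' - C a' a) = 2 ^ Fintype.card κ * pfaffianSum C := by
  have h1 : ∀ σ : Perm (κ × Fin 2),
      ((Perm.sign σ : ℤ) : R) * ∏ j, (C (σ (j, 0)) (σ (j, 1)) - C (σ (j, 1)) (σ (j, 0))) =
      ∑ τ : κ → Perm (Fin 2), ((Perm.sign (σ * prodCongrRight τ) : ℤ) : R) *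
        ∏ j, C ((σ * prodCongrRight τ) (j, 0)) ((σ * prodCongrRight τ) (j, 1)) := by
    intro σ
    have h2 : ∀ j, C (σ (j, 0)) (σ (j, 1)) - C (σ (j, 1)) (σ (j, 0)) =
        ∑ t : Perm (Fin 2), ((Perm.sign t : ℤ) : R) * C (σ (j, t 0)) (σ (j, t 1)) := by
      intro j
      rw [show (Finset.univ : Finset (Perm (Fin 2))) = {1, swap 0 1} by decide,
        Finset.sum_insert (by decide), Finset.sum_singleton]
      simp [sub_eq_add_neg]
    simp only [h2]
    rw [Finset.prod_univ_sum, Fintype.piFinset_univ, Finset.mul_sum]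
    refine Finset.sum_congr rfl fun τ _ => ?_
    rw [Finset.prod_mul_distrib, Perm.sign_mul, Perm.sign_prodCongrRight]
    simp [mul_assoc]
  simp only [pfaffianSum]
  simp only [h1]
  rw [Finset.sum_comm]
  have h3 : ∀ τ : κ → Perm (Fin 2), ∑ σ : Perm (κ × Fin 2),
      ((Perm.sign (σ * prodCongrRight τ) : ℤ) : R) *
        ∏ j, C ((σ * prodCongrRight τ) (j, 0)) ((σ * prodCongrRight τ) (j, 1)) =
      ∑ σ : Perm (κ × Fin 2), ((Perm.sign σ : ℤ) : R) * ∏ j, C (σ (j, 0)) (σ (j, 1)) := fun τ =>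
    Fintype.sum_equiv (Equiv.mulRight (prodCongrRight τ)) _ _ fun σ => rfl
  simp only [h3]
  simp [Fintype.card_perm]

/-- The matrix with rows `x k`, `y k`, indexed by the pairs `(k, 0)`, `(k, 1)`. -/
def pairRows {R α : Type*} (x y : κ → α → R) : Matrix (κ × Fin 2) α R :=
  Matrix.of fun p => if p.2 = 0 then x p.1 else y p.1

/-- Expanding the product gives one determinant for each `f : κ → κ`. If `f` is not injective, a row
is repeated; if `f` is a permutation, it moves the rows in pairs, hence evenly, and each of the
`|κ|!` terms is the same determinant. -/
theorem pfaffianSum_sum_mul {R : Type*} [CommRing R] (x y : κ → κ × Fin 2 → R) :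
    pfaffianSum (fun a a' => ∑ k, x k a * y k a') =
      (Fintype.card κ).factorial * (pairRows x y).det := by
  have h1 : pfaffianSum (fun a a' => ∑ k, x k a * y k a') =
      ∑ f : κ → κ, (pairRows (x ∘ f) (y ∘ f)).det := by
    simp only [pfaffianSum]
    simp only [Finset.prod_univ_sum, Fintype.piFinset_univ, Finset.mul_sum]
    rw [Finset.sum_comm]
    refine Finset.sum_congr rfl fun f _ => ?_
    rw [← Matrix.det_transpose, Matrix.det_apply']
    refine Finset.sum_congr rfl fun σ _ => ?_
    rw [Fintype.prod_prod_type]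
    simp [Fin.prod_univ_two, pairRows]
  rw [h1]
  have h2 : ∀ f : κ → κ, ¬ Function.Bijective f → (pairRows (x ∘ f) (y ∘ f)).det = 0 := by
    intro f hf
    have : ¬ Function.Injective f := fun h => hf (Finite.injective_iff_bijective.mp h)
    simp only [Function.Injective, not_forall] at this
    obtain ⟨i, j, hij, hne⟩ := this
    refine Matrix.det_zero_of_row_eq (i := (i, 0)) (j := (j, 0)) (by simpa using hne) ?_
    ext a
    simp [pairRows, hij]
  have h3 : ∀ τ : Perm κ, (pairRows (x ∘ τ) (y ∘ τ)).det = (pairRows x y).det := by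
    intro τ
    have : pairRows (x ∘ τ) (y ∘ τ) =
        (pairRows x y).submatrix (prodCongrLeft fun _ : Fin 2 => τ) id := by
      ext p a
      simp [pairRows]
    rw [this, Matrix.det_permute, Perm.sign_prodCongrLeft]
    simp
  rw [← Finset.sum_subset (Finset.subset_univ
    (Finset.univ.map ⟨fun τ : Perm κ => (τ : κ → κ), DFunLike.coe_injective⟩))]
  · rw [Finset.sum_map]
    simp [h3, Fintype.card_perm]
  · intro f _ hf
    apply h2
    intro hb
    apply hf
    simp only [Finset.mem_map, Finset.mem_univ, true_and]
    exact ⟨Equiv.ofBijective f hb, rfl⟩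

/-- With `y k = i ∑ l, h k l * conj (z l)`, the form `B` is the antisymmetrisation of `∑ z k ⊗ y k`,
so the two previous lemmas reduce the sum to the determinant of the rows `z, y`. These rows come
from the real and imaginary parts of `z` by the blocks `(1, i; 1, -i)` followed by `diag(1, i h)`.
-/
theorem pfaffianSum_hermitian (h : Matrix κ κ ℂ) (z : κ → κ × Fin 2 → ℂ)
    (B : κ × Fin 2 → κ × Fin 2 → ℝ)
    (hB : ∀ a a', (B a a' : ℂ) = Complex.I *
      ((∑ k, ∑ l, h k l * (z k a * starRingEnd ℂ (z l a'))) -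
        ∑ k, ∑ l, h k l * (z k a' * starRingEnd ℂ (z l a)))) :
    ((pfaffianSum B : ℝ) : ℂ) = 4 ^ Fintype.card κ * (Fintype.card κ).factorial * h.det *
      ((pairRows (fun k a => (z k a).re) (fun k a => (z k a).im)).det : ℝ) := by
  have e1 : ((pfaffianSum B : ℝ) : ℂ) = pfaffianSum (fun a a' => (B a a' : ℂ)) := by
    simp [pfaffianSum]
  let y : κ → κ × Fin 2 → ℂ := fun k a => Complex.I * ∑ l, h k l * starRingEnd ℂ (z l a)
  have e2 : (fun a a' => (B a a' : ℂ)) = fun a a' =>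
      (fun a a' => ∑ k, z k a * y k a') a a' - (fun a a' => ∑ k, z k a * y k a') a' a := by
    ext a a'
    rw [hB, mul_sub]
    simp only [y, Finset.mul_sum]
    congr 1 <;> refine Finset.sum_congr rfl fun k _ => Finset.sum_congr rfl fun l _ => by ring
  have e3 : pairRows z y =
      (Matrix.blockDiagonal fun s : Fin 2 => if s = 0 then (1 : Matrix κ κ ℂ)
        else Complex.I • h) *
      (Matrix.kronecker (1 : Matrix κ κ ℂ) !![1, Complex.I; 1, -Complex.I] *
        (pairRows (fun k a => (z k a).re) (fun k a => (z k a).im)).map Complex.ofReal) := by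
    have e4 : Matrix.kronecker (1 : Matrix κ κ ℂ) !![1, Complex.I; 1, -Complex.I] *
        (pairRows (fun k a => (z k a).re) (fun k a => (z k a).im)).map Complex.ofReal =
        pairRows z (fun k a => starRingEnd ℂ (z k a)) := by
      ext ⟨k, s⟩ a
      rw [Matrix.mul_apply, Fintype.sum_prod_type]
      rw [Finset.sum_eq_single k]
      · fin_cases s
        · simp [pairRows, Matrix.kronecker, Complex.ext_iff]
        · simp [pairRows, Matrix.kronecker, Complex.ext_iff]
      · intro l _ hl
        simp [Matrix.kronecker, Matrix.one_apply_ne hl.symm]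
      · simp
    rw [e4]
    ext ⟨k, s⟩ a
    rw [Matrix.mul_apply, Fintype.sum_prod_type]
    fin_cases s
    · simp [pairRows, Matrix.blockDiagonal_apply, Matrix.one_apply]
    · simp [pairRows, Matrix.blockDiagonal_apply, y, Finset.mul_sum, mul_assoc]
  rw [e1, e2, pfaffianSum_sub_swap, pfaffianSum_sum_mul, e3, Matrix.det_mul, Matrix.det_mul,
    Matrix.det_blockDiagonal, Matrix.kronecker, Matrix.det_kronecker]
  have e5 : (Complex.ofRealHom.mapMatrix
      (pairRows (fun k a => (z k a).re) (fun k a => (z k a).im))).det =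
      (((pairRows (fun k a => (z k a).re) (fun k a => (z k a).im)).det : ℝ) : ℂ) :=
    (RingHom.map_det Complex.ofRealHom _).symm
  have e6 : (pairRows (fun k a => (z k a).re) (fun k a => (z k a).im)).map Complex.ofReal =
    Complex.ofRealHom.mapMatrix
      (pairRows (fun k a => (z k a).re) (fun k a => (z k a).im)) := rfl
  rw [e6, e5]
  simp only [Fin.prod_univ_two, Matrix.det_one, one_pow, Matrix.det_fin_two_of, if_true]
  -- Per index: `2` from antisymmetrising, `i` from the block `i h`, and `-2i` from `det (1, i; 1,
  -- -i)`, with product `4`.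
  have e7 : (2 : ℂ) ^ Fintype.card κ * Complex.I ^ Fintype.card κ *
      (1 * -Complex.I - Complex.I * 1) ^ Fintype.card κ = 4 ^ Fintype.card κ := by
    rw [← mul_pow, ← mul_pow]
    congr 1
    linear_combination (-4) * Complex.I_mul_I
  simp only [one_ne_zero, if_false, one_mul]
  rw [← e7, Matrix.det_smul]
  ring

end Pfaffian

/-! ### Unitary bases, real frames and densities -/

section Frames

/-- The pair `(j, s)` is the index `2 j + s`. -/
def pairEquiv (k : ℕ) : Fin k × Fin 2 ≃ Fin (2 * k) :=
  finProdFinEquiv.trans (finCongr (mul_comm k 2))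

theorem pairEquiv_val (k : ℕ) (p : Fin k × Fin 2) :
    (pairEquiv k p : ℕ) = 2 * p.1 + p.2 := by
  simp [pairEquiv]
  ring

theorem two_pow_mul_wedgePow_eq_pfaffianSum {V : Type*} [AddCommGroup V] [Module ℝ V]
    (b : V [⋀^Fin 2]→ₗ[ℝ] ℝ) (k : ℕ) (v : Fin k × Fin 2 → V) :
    2 ^ k * wedgePow b k (v ∘ (pairEquiv k).symm) = pfaffianSum fun a a' => b ![v a, v a'] := by
  rw [two_pow_mul_wedgePow, pfaffianSum]
  refine Fintype.sum_equiv ((pairEquiv k).permCongr.symm) _ _ fun σ => ?_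
  have h0 : ∀ j : Fin k, (⟨2 * j, by omega⟩ : Fin (2 * k)) = pairEquiv k (j, 0) := fun j =>
    Fin.ext (by simp [pairEquiv_val])
  have h1 : ∀ j : Fin k, (⟨2 * j + 1, by omega⟩ : Fin (2 * k)) = pairEquiv k (j, 1) := fun j =>
    Fin.ext (by simp [pairEquiv_val])
  simp [h0, h1]

/-- The factors `1` and `i`. -/
def unitFactor (s : Fin 2) : ℂ := if s = 0 then 1 else Complex.I

/-- For vectors with complex coordinates `1` and `i` along the basis, the real coordinate matrix in
`pfaffianSum_hermitian` is the identity. Of its `4^k`, a factor `2^k` is the normalisation of the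
wedge power. -/
theorem wedgePow_of_hermitian {V : Type*} [AddCommGroup V] [Module ℝ V]
    (b : V [⋀^Fin 2]→ₗ[ℝ] ℝ) {k : ℕ} (v : Fin k × Fin 2 → V) (h : Matrix (Fin k) (Fin k) ℂ)
    (hb : ∀ a a', (b ![v a, v a'] : ℂ) = Complex.I *
      (h a.1 a'.1 * (unitFactor a.2 * starRingEnd ℂ (unitFactor a'.2)) -
        h a'.1 a.1 * (unitFactor a'.2 * starRingEnd ℂ (unitFactor a.2)))) :
    (wedgePow b k (v ∘ (pairEquiv k).symm) : ℂ) = 2 ^ k * k.factorial * h.det := by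
  have h1 := pfaffianSum_hermitian h
    (fun l a => if a.1 = l then unitFactor a.2 else 0) (fun a a' => b ![v a, v a']) (by
      intro a a'
      rw [hb]
      simp [apply_ite (starRingEnd ℂ)])
  rw [← two_pow_mul_wedgePow_eq_pfaffianSum] at h1
  have h2 : pairRows (fun l (a : Fin k × Fin 2) => (if a.1 = l then unitFactor a.2 else 0).re)
      (fun l a => (if a.1 = l then unitFactor a.2 else 0).im) = 1 := by
    ext ⟨l, s⟩ ⟨j, t⟩
    by_cases hj : j = l
    · subst hj
      fin_cases s <;> fin_cases t <;> simp [pairRows, unitFactor]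
    · have hj' : l ≠ j := fun h => hj h.symm
      fin_cases s <;> simp [pairRows, hj, hj']
  rw [h2, Matrix.det_one] at h1
  have h3 : (4 : ℂ) ^ k = 2 ^ k * 2 ^ k := by rw [← mul_pow]; norm_num
  push_cast at h1
  rw [Fintype.card_fin, h3] at h1
  have h4 : (2 : ℂ) ^ k ≠ 0 := pow_ne_zero _ two_ne_zero
  apply mul_left_cancel₀ h4
  rw [h1]
  ring

theorem volForm_eq_det_std (n : ℕ) (v : Fin n × Fin 2 → Cn n) :
    volForm n (v ∘ (pairEquiv n).symm) =
      (pairRows (fun k a => (v a k).re) (fun k a => (v a k).im)).det := by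
  rw [← Matrix.det_transpose, ← Matrix.det_reindex_self (pairEquiv n)]
  simp only [volForm, AlternatingMap.compLinearMap_apply]
  change Matrix.det _ = _
  congr 1
  ext i j
  obtain ⟨⟨k, s⟩, rfl⟩ := (pairEquiv n).surjective j
  have hk : (2 * (k : ℕ) + s) / 2 = k := by omega
  simp only [Matrix.reindex_apply, Matrix.submatrix_apply, Matrix.transpose_apply,
    Equiv.symm_apply_apply, pairRows, Matrix.of_apply, realCoords, LinearMap.coe_mk,
    AddHom.coe_mk, pairEquiv_val, Function.comp_apply, hk]
  fin_cases s <;> simp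

/-- Unitary maps have real determinant `1`. Here this follows from `pfaffianSum_hermitian` with `h =
1`: the Pfaffian sum of the Kähler form does not involve the basis, so the determinants for `u` and
for the standard basis agree after cancelling a nonzero constant. -/
theorem volForm_eq_det {n : ℕ} (u : OrthonormalBasis (Fin n) ℂ (Cn n))
    (v : Fin n × Fin 2 → Cn n) :
    volForm n (v ∘ (pairEquiv n).symm) =
      (pairRows (fun k a => (inner ℂ (u k) (v a)).re)
        (fun k a => (inner ℂ (u k) (v a)).im)).det := by
  have key : ∀ u : OrthonormalBasis (Fin n) ℂ (Cn n),
      ((pfaffianSum (fun a a' => -2 * (inner ℂ (v a') (v a)).im) : ℝ) : ℂ) =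
      4 ^ Fintype.card (Fin n) * (Fintype.card (Fin n)).factorial *
        (1 : Matrix (Fin n) (Fin n) ℂ).det *
      ((pairRows (fun k a => (inner ℂ (u k) (v a)).re)
        (fun k a => (inner ℂ (u k) (v a)).im)).det : ℝ) := by
    intro u
    refine pfaffianSum_hermitian _ _ _ fun a a' => ?_
    have h1 : ∀ a a' : Fin n × Fin 2, ∑ k, ∑ l, (1 : Matrix (Fin n) (Fin n) ℂ) k l *
        (inner ℂ (u k) (v a) * starRingEnd ℂ (inner ℂ (u l) (v a'))) = inner ℂ (v a') (v a) := by
      intro a a'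
      rw [← u.sum_inner_mul_inner (v a') (v a)]
      refine Finset.sum_congr rfl fun k _ => ?_
      simp [Matrix.one_apply, mul_comm]
    have h2 : inner ℂ (v a) (v a') = starRingEnd ℂ (inner ℂ (v a') (v a)) :=
      (inner_conj_symm _ _).symm
    rw [h1, h1, h2]
    generalize inner ℂ (v a') (v a) = w
    apply Complex.ext <;> simp
    ring
  have h1 := key u
  rw [key (EuclideanSpace.basisFun (Fin n) ℂ)] at h1
  rw [volForm_eq_det_std]
  have h2 : (4 : ℂ) ^ Fintype.card (Fin n) * (Fintype.card (Fin n)).factorial *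
      (1 : Matrix (Fin n) (Fin n) ℂ).det ≠ 0 := by
    rw [Matrix.det_one, mul_one]
    exact mul_ne_zero (pow_ne_zero _ (by norm_num)) (by exact_mod_cast Nat.factorial_ne_zero _)
  have h3 := Complex.ofReal_injective (mul_left_cancel₀ h2 h1)
  rw [← h3]
  simp only [EuclideanSpace.basisFun_inner]

/-- The real orthonormal basis `u₀, i u₀, u₁, i u₁, …`. -/
def realFrame {κ E : Type*} [SMul ℂ E] (u : κ → E) (p : κ × Fin 2) : E :=
  unitFactor p.2 • u p.1

theorem inner_realFrame {n : ℕ} (u : OrthonormalBasis (Fin n) ℂ (Cn n)) (k : Fin n)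
    (p : Fin n × Fin 2) :
    inner ℂ (u k) (realFrame u p) = if k = p.1 then unitFactor p.2 else 0 := by
  rw [realFrame, inner_smul_right, orthonormal_iff_ite.mp u.orthonormal]
  simp

theorem volForm_realFrame {n : ℕ} (u : OrthonormalBasis (Fin n) ℂ (Cn n)) :
    volForm n (realFrame u ∘ (pairEquiv n).symm) = 1 := by
  rw [volForm_eq_det u]
  have : pairRows (fun k a => (inner ℂ (u k) (realFrame u a)).re)
      (fun k a => (inner ℂ (u k) (realFrame u a)).im) = 1 := by
    ext ⟨l, s⟩ ⟨j, t⟩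
    by_cases hj : l = j
    · subst hj
      fin_cases s <;> fin_cases t <;> simp [pairRows, inner_realFrame, unitFactor]
    · fin_cases s <;> simp [pairRows, hj, inner_realFrame]
  rw [this, Matrix.det_one]

theorem reInner_realFrame {n : ℕ} (u : OrthonormalBasis (Fin n) ℂ (Cn n))
    (p q : Fin n × Fin 2) :
    reInner (realFrame u p) (realFrame u q) = if p = q then 1 else 0 := by
  obtain ⟨k, s⟩ := p
  obtain ⟨l, t⟩ := q
  rw [reInner, realFrame, inner_smul_left, inner_realFrame]
  by_cases hj : k = l
  · subst hj
    fin_cases s <;> fin_cases t <;> simp [unitFactor]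
  · simp [hj]

theorem sum_reInner_realFrame {n : ℕ} (u : OrthonormalBasis (Fin n) ℂ (Cn n)) (ζ : Cn n) :
    ∑ p, reInner (realFrame u p) ζ • realFrame u p = ζ := by
  conv_rhs => rw [← u.sum_repr' ζ]
  rw [Fintype.sum_prod_type]
  refine Finset.sum_congr rfl fun k _ => ?_
  simp only [Fin.sum_univ_two, realFrame, reInner, unitFactor, inner_smul_left]
  conv_rhs => rw [← Complex.re_add_im (inner ℂ (u k) ζ)]
  rw [add_smul, mul_smul, Complex.coe_smul, Complex.coe_smul]
  simp

/-- The frame `i u₀, u₁, i u₁, …` of the real orthogonal complement of `u₀`. -/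
def tangentFrame {m : ℕ} {E : Type*} [SMul ℂ E] (u : Fin (m + 1) → E) (j : Fin (1 + 2 * m)) : E :=
  -- The shift by one drops position `0`, which carries `u 0`.
  realFrame u ((pairEquiv (m + 1)).symm ⟨j + 1, by omega⟩)

theorem tangentFrame_zero {m : ℕ} {E : Type*} [SMul ℂ E] (u : Fin (m + 1) → E) :
    tangentFrame u (Fin.castAdd (2 * m) 0) = Complex.I • u 0 := by
  have : (pairEquiv (m + 1)).symm ⟨(Fin.castAdd (2 * m) (0 : Fin 1) : ℕ) + 1, by simp; omega⟩ =
      (0, 1) := by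
    rw [Equiv.symm_apply_eq]
    exact Fin.ext (by simp [pairEquiv_val])
  rw [tangentFrame, this]
  simp [realFrame, unitFactor]

theorem tangentFrame_natAdd {m : ℕ} {E : Type*} [SMul ℂ E] (u : Fin (m + 1) → E)
    (p : Fin m × Fin 2) :
    tangentFrame u (Fin.natAdd 1 (pairEquiv m p)) = realFrame (u ∘ Fin.succ) p := by
  have : (pairEquiv (m + 1)).symm ⟨(Fin.natAdd 1 (pairEquiv m p) : ℕ) + 1, by omega⟩ =
      (p.1.succ, p.2) := by
    rw [Equiv.symm_apply_eq]
    refine Fin.ext ?_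
    simp only [pairEquiv_val, Fin.val_natAdd, Fin.val_succ]
    ring
  rw [tangentFrame, this]
  simp [realFrame]

theorem realFrame_pairEquiv_symm_zero {m : ℕ} {E : Type*} [MulAction ℂ E] (u : Fin (m + 1) → E)
    (h : 0 < 2 * (m + 1)) : realFrame u ((pairEquiv (m + 1)).symm ⟨0, h⟩) = u 0 := by
  have : (pairEquiv (m + 1)).symm ⟨0, h⟩ = (0, 0) := by
    rw [Equiv.symm_apply_eq]
    exact Fin.ext (by simp [pairEquiv_val])
  rw [this]
  simp [realFrame, unitFactor]

theorem reInner_tangentFrame {m : ℕ} (u : OrthonormalBasis (Fin (m + 1)) ℂ (Cn (m + 1)))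
    (j k : Fin (1 + 2 * m)) :
    reInner (tangentFrame u j) (tangentFrame u k) = if j = k then 1 else 0 := by
  rw [tangentFrame, tangentFrame, reInner_realFrame]
  simp [Fin.ext_iff]

theorem reInner_tangentFrame_left {m : ℕ} (u : OrthonormalBasis (Fin (m + 1)) ℂ (Cn (m + 1)))
    (k : Fin (1 + 2 * m)) : reInner (u 0) (tangentFrame u k) = 0 := by
  rw [← realFrame_pairEquiv_symm_zero u (by omega), tangentFrame, reInner_realFrame]
  simp

theorem sum_reInner_tangentFrame {m : ℕ} (u : OrthonormalBasis (Fin (m + 1)) ℂ (Cn (m + 1)))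
    {ζ : Cn (m + 1)} (hζ : reInner (u 0) ζ = 0) :
    ∑ j, reInner (tangentFrame u j) ζ • tangentFrame u j = ζ := by
  conv_rhs => rw [← sum_reInner_realFrame u ζ, ← Equiv.sum_comp (pairEquiv (m + 1)).symm,
    ← Equiv.sum_comp (finCongr (show 1 + 2 * m + 1 = 2 * (m + 1) by ring)), Fin.sum_univ_succ]
  have h0 : realFrame u ((pairEquiv (m + 1)).symm
      ((finCongr (show 1 + 2 * m + 1 = 2 * (m + 1) by ring)) 0)) = u 0 :=
    realFrame_pairEquiv_symm_zero u (by omega)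
  rw [h0, hζ, zero_smul, zero_add]
  rfl

variable {m : ℕ} [NeZero (m + 1)]

/-- Contracting with the normal prepends `u 0`, which restores the full frame `u₀, iu₀, u₁, iu₁, …`
of volume `1`. -/
theorem boundaryVolForm_tangentFrame (A : Set (Cn (m + 1))) (z : Cn (m + 1))
    (u : OrthonormalBasis (Fin (m + 1)) ℂ (Cn (m + 1))) (hu : u 0 = gaussMap A z) :
    boundaryVolForm A z (tangentFrame u) = 1 := by
  rw [← volForm_realFrame u, boundaryVolForm, AlternatingMap.curryLeft_apply_apply,
    AlternatingMap.domDomCongr_apply]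
  congr 1
  ext1 i
  obtain ⟨j, rfl⟩ := (finCongr (show 1 + 2 * m + 1 = 2 * (m + 1) by ring)).surjective i
  refine Fin.cases ?_ (fun j => ?_) j
  · exact hu.symm.trans (realFrame_pairEquiv_symm_zero u (by omega)).symm
  · rfl

theorem isPositiveFrame_tangentFrame (A : Set (Cn (m + 1))) (z : Cn (m + 1))
    (u : OrthonormalBasis (Fin (m + 1)) ℂ (Cn (m + 1))) (hu : u 0 = gaussMap A z) :
    IsPositiveFrame A z (tangentFrame u) where
  mem_tangent j := by
    simp only [tangentHyperplane, Set.mem_ofPred_eq, ← hu]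
    exact reInner_tangentFrame_left u j
  orthonormal := reInner_tangentFrame u
  pos := by
    rw [boundaryVolForm_tangentFrame A z u hu]
    exact one_pos

theorem map_sum_smul_eq_det_mul {V : Type*} [AddCommGroup V] [Module ℝ V] {N : ℕ}
    (ω : V [⋀^Fin N]→ₗ[ℝ] ℝ) (f : Fin N → V) (c : Matrix (Fin N) (Fin N) ℝ) :
    ω (fun j => ∑ k, c j k • f k) = c.det * ω f := by
  have h1 := (ω.compLinearMap (Fintype.linearCombination ℝ f)).eq_smul_basis_det
    (Pi.basisFun ℝ (Fin N))
  have h2 : ω (fun j => ∑ k, c j k • f k) =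
      (ω.compLinearMap (Fintype.linearCombination ℝ f)) (fun j => c j) := by
    simp only [AlternatingMap.compLinearMap_apply, Fintype.linearCombination_apply]
  rw [h2, h1, AlternatingMap.smul_apply, smul_eq_mul, mul_comm, Pi.basisFun_det_apply]
  refine congrArg₂ (· * ·) rfl ?_
  rw [AlternatingMap.compLinearMap_apply]
  congr 1
  ext1 k
  simp [Fintype.linearCombination_apply, Pi.single_apply]

/-- The transition matrix between the frames is orthogonal, so its determinant is `±1`; positivity
on the boundary volume form selects `1`. -/
theorem IsPositiveFrame.apply_eq {A : Set (Cn (m + 1))} {z : Cn (m + 1)}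
    {e : Fin (1 + 2 * m) → Cn (m + 1)} (he : IsPositiveFrame A z e)
    (u : OrthonormalBasis (Fin (m + 1)) ℂ (Cn (m + 1))) (hu : u 0 = gaussMap A z)
    (ω : Cn (m + 1) [⋀^Fin (1 + 2 * m)]→ₗ[ℝ] ℝ) : ω e = ω (tangentFrame u) := by
  let c : Matrix (Fin (1 + 2 * m)) (Fin (1 + 2 * m)) ℝ :=
    Matrix.of fun j k => reInner (tangentFrame u k) (e j)
  have hc : ∀ j, ∑ k, c j k • tangentFrame u k = e j := fun j => by
    refine sum_reInner_tangentFrame u ?_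
    rw [hu]
    exact he.mem_tangent j
  have hω : ∀ ω : Cn (m + 1) [⋀^Fin (1 + 2 * m)]→ₗ[ℝ] ℝ, ω e = c.det * ω (tangentFrame u) := by
    intro ω
    rw [← map_sum_smul_eq_det_mul]
    simp only [hc]
  have hcc : c * c.transpose = 1 := by
    ext j k
    rw [Matrix.mul_apply, Matrix.one_apply, ← he.orthonormal j k]
    conv_rhs => rw [← hc j]
    simp [reInner, c]
  have hdet : c.det * c.det = 1 := by
    have := congrArg Matrix.det hcc
    rwa [Matrix.det_mul, Matrix.det_transpose, Matrix.det_one] at this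
  have hpos : 0 < c.det := by
    have := he.pos
    have h2 := hω (boundaryVolForm A z)
    rw [boundaryVolForm_tangentFrame A z u hu, mul_one] at h2
    rwa [← h2]
  rw [hω, show c.det = 1 by nlinarith, one_mul]

theorem formDensity_eq (A : Set (Cn (m + 1))) (z : Cn (m + 1))
    (u : OrthonormalBasis (Fin (m + 1)) ℂ (Cn (m + 1))) (hu : u 0 = gaussMap A z)
    (ω : Cn (m + 1) [⋀^Fin (1 + 2 * m)]→ₗ[ℝ] ℝ) :
    formDensity A z ω = ω (tangentFrame u) := by
  have h : ∃ e, IsPositiveFrame A z e := ⟨_, isPositiveFrame_tangentFrame A z u hu⟩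
  unfold formDensity
  rw [dif_pos h]
  exact IsPositiveFrame.apply_eq h.choose_spec u hu ω

end Frames

/-! ### Level sets of submersions -/

section LevelSets

open Set Filter

variable {E : Type*} [NormedAddCommGroup E] [NormedSpace ℝ E] [CompleteSpace E]
  {f : E → ℝ} {f' : E →L[ℝ] ℝ} {p : E}

omit [CompleteSpace E] in
theorem range_eq_top_of_ne_zero (hf' : f' ≠ 0) : f'.range = ⊤ := by
  have h : (f' : E →ₗ[ℝ] ℝ) ≠ 0 := fun h => hf' (by ext x; exact congrArg (fun F => F x) h)
  exact LinearMap.range_eq_top.mpr (LinearMap.surjective h)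

/-- The implicit function parametrises the level set by `ker f'`, with derivative at `0` the
inclusion. It carries the tangent cone of a neighbourhood of `0`, which is all of `ker f'`, into
that of `s`. -/
theorem mem_tangentConeAt_of_apply_eq_zero (hf : HasStrictFDerivAt f f' p) (hf' : f' ≠ 0)
    (hp : f p = 0) {s : Set E} (hs : ∀ᶠ x in 𝓝 p, f x = 0 → x ∈ s) {v : E} (hv : f' v = 0) :
    v ∈ tangentConeAt ℝ s p := by
  have hr := range_eq_top_of_ne_zero hf'
  let φ := hf.implicitFunction f f' hr (f p)
  have hφ : HasStrictFDerivAt φ f'.ker.subtypeL 0 := hf.to_implicitFunction hr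
  have hφ0 : φ 0 = p := hf.implicitFunction_apply_image hr
  have h1 : ∀ᶠ y in 𝓝 (0 : f'.ker), f (φ y) = 0 := by
    have := (Continuous.tendsto (f := fun y : f'.ker => (f p, y)) (by fun_prop) 0).eventually
      (hf.map_implicitFunction_eq hr)
    filter_upwards [this] with y hy using hy.trans hp
  have h2 : ∀ᶠ y in 𝓝 (0 : f'.ker), f (φ y) = 0 → φ y ∈ s := by
    have hc : Tendsto φ (𝓝 0) (𝓝 p) := by
      have := hφ.continuousAt.tendsto
      rwa [hφ0] at this
    exact hc.eventually hs
  have h3 : {y | φ y ∈ s} ∈ 𝓝 (0 : f'.ker) := by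
    filter_upwards [h1, h2] with y h1 h2 using h2 h1
  have h4 := (hφ.hasFDerivAt.hasFDerivWithinAt (s := {y | φ y ∈ s})).mapsTo_tangent_cone
  rw [tangentConeAt_of_mem_nhds h3, hφ0] at h4
  have h5 := h4 (mem_univ (⟨v, hv⟩ : f'.ker))
  exact tangentConeAt_mono (by rintro _ ⟨y, hy, rfl⟩; exact hy) h5

/-- A chart straightens `f` to the first coordinate. `W` corresponds to a product of balls, and its
two sides to convex sets whose closures contain the slice `0`. -/
theorem exists_isOpen_isPreconnected_sides (hf : HasStrictFDerivAt f f' p) (hf' : f' ≠ 0)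
    (hp : f p = 0) {U : Set E} (hU : U ∈ 𝓝 p) :
    ∃ W ⊆ U, IsOpen W ∧ p ∈ W ∧ IsPreconnected (W ∩ {x | 0 < f x}) ∧
      IsPreconnected (W ∩ {x | f x < 0}) ∧
      W ∩ {x | f x = 0} ⊆ closure (W ∩ {x | 0 < f x}) ∩ closure (W ∩ {x | f x < 0}) := by
  have hr := range_eq_top_of_ne_zero hf'
  let Φ := hf.implicitToOpenPartialHomeomorph f f' hr
  have hps : p ∈ Φ.source := hf.mem_implicitToOpenPartialHomeomorph_source hr
  have hΦp : Φ p = (0, 0) := by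
    rw [← hp]
    exact hf.implicitToOpenPartialHomeomorph_self hr
  have hfst : ∀ y ∈ Φ.target, f (Φ.symm y) = y.1 := by
    intro y hy
    have := hf.implicitToOpenPartialHomeomorph_fst hr (Φ.symm y)
    rw [← this]
    exact congrArg Prod.fst (Φ.right_inv hy)
  have hpt : ((0 : ℝ), (0 : f'.ker)) ∈ Φ.target := hΦp ▸ Φ.map_source hps
  have hsymm : Φ.symm (0, 0) = p := by rw [← hΦp, Φ.left_inv hps]
  have hN : Φ.target ∩ Φ.symm ⁻¹' U ∈ 𝓝 ((0 : ℝ), (0 : f'.ker)) := by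
    refine inter_mem (Φ.open_target.mem_nhds hpt) ?_
    have := (Φ.symm.continuousAt (x := (0, 0)) hpt).preimage_mem_nhds (t := U)
    rw [hsymm] at this
    exact this hU
  obtain ⟨r, hr0, hball⟩ := Metric.mem_nhds_iff.mp hN
  rw [← ball_prod_same] at hball
  have htar : ∀ y ∈ Metric.ball (0 : ℝ) r ×ˢ Metric.ball (0 : f'.ker) r, y ∈ Φ.target :=
    fun y hy => (hball hy).1
  have hside : ∀ I : Set ℝ, (Φ.symm '' (Metric.ball (0 : ℝ) r ×ˢ Metric.ball (0 : f'.ker) r)) ∩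
      {x | f x ∈ I} =
      Φ.symm '' ((Metric.ball (0 : ℝ) r ∩ I) ×ˢ Metric.ball (0 : f'.ker) r) := by
    intro I
    ext x
    constructor
    · rintro ⟨⟨y, hy, rfl⟩, hx⟩
      refine ⟨y, ⟨⟨hy.1, ?_⟩, hy.2⟩, rfl⟩
      rw [← hfst y (htar y hy)]
      exact hx
    · rintro ⟨y, hy, rfl⟩
      have hy' : y ∈ Metric.ball (0 : ℝ) r ×ˢ Metric.ball (0 : f'.ker) r := ⟨hy.1.1, hy.2⟩
      refine ⟨⟨y, hy', rfl⟩, ?_⟩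
      change f _ ∈ I
      rw [hfst y (htar y hy')]
      exact hy.1.2
  have hconn : ∀ I : Set ℝ, Convex ℝ I →
      IsPreconnected (Φ.symm '' ((Metric.ball (0 : ℝ) r ∩ I) ×ˢ Metric.ball (0 : f'.ker) r)) := by
    intro I hI
    refine IsPreconnected.image ?_ _ (Φ.symm.continuousOn.mono fun y hy =>
      htar y ⟨hy.1.1, hy.2⟩)
    exact (((convex_ball _ _).inter hI).prod (convex_ball _ _)).isPreconnected
  have hcl : ∀ I : Set ℝ, (0 : ℝ) ∈ closure (Metric.ball (0 : ℝ) r ∩ I) → ∀ x,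
      x ∈ Φ.symm '' (Metric.ball (0 : ℝ) r ×ˢ Metric.ball (0 : f'.ker) r) → f x = 0 →
      x ∈ closure (Φ.symm '' ((Metric.ball (0 : ℝ) r ∩ I) ×ˢ Metric.ball (0 : f'.ker) r)) := by
    rintro I hI _ ⟨y, hy, rfl⟩ hx
    rw [hfst y (htar y hy)] at hx
    refine mem_closure_image (Φ.symm.continuousAt (htar y hy)) ?_
    rw [closure_prod_eq]
    exact ⟨hx ▸ hI, subset_closure hy.2⟩
  refine ⟨Φ.symm '' (Metric.ball (0 : ℝ) r ×ˢ Metric.ball (0 : f'.ker) r), ?_, ?_, ?_, ?_, ?_, ?_⟩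
  · rintro _ ⟨y, hy, rfl⟩
    exact (hball hy).2
  · exact Φ.isOpen_image_symm_of_subset_target (Metric.isOpen_ball.prod Metric.isOpen_ball) htar
  · exact ⟨(0, 0), ⟨Metric.mem_ball_self hr0, Metric.mem_ball_self hr0⟩, hsymm⟩
  · exact (hside (Ioi 0)).symm ▸ hconn _ (convex_Ioi 0)
  · exact (hside (Iio 0)).symm ▸ hconn _ (convex_Iio 0)
  · rintro x ⟨hx, hx0⟩
    constructor
    · refine (hside (Ioi 0)).symm ▸ hcl _ ?_ x hx hx0
      have : Metric.ball (0 : ℝ) r ∩ Ioi 0 = Ioo 0 r := by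
        rw [Real.ball_eq_Ioo]
        ext t
        simp only [mem_inter_iff, mem_Ioo, mem_Ioi]
        constructor
        · rintro ⟨⟨_, h⟩, h'⟩
          exact ⟨h', by simpa using h⟩
        · rintro ⟨h, h'⟩
          exact ⟨⟨by linarith, by simpa using h'⟩, h⟩
      rw [this, closure_Ioo hr0.ne]
      exact left_mem_Icc.mpr hr0.le
    · refine (hside (Iio 0)).symm ▸ hcl _ ?_ x hx hx0
      have : Metric.ball (0 : ℝ) r ∩ Iio 0 = Ioo (-r) 0 := by
        rw [Real.ball_eq_Ioo]
        ext t
        simp only [mem_inter_iff, mem_Ioo, mem_Iio]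
        constructor
        · rintro ⟨⟨h, _⟩, h'⟩
          exact ⟨by simpa using h, h'⟩
        · rintro ⟨h, h'⟩
          exact ⟨⟨by simpa using h, by linarith⟩, h'⟩
      rw [this, closure_Ioo (by linarith)]
      exact right_mem_Icc.mpr (by linarith)

/-- Locally the level set lies in the image, under a Lipschitz map, of a ball of the `d`-dimensional
space `ker f'`. -/
theorem exists_hausdorffMeasure_levelSet_lt_top [FiniteDimensional ℝ E] [MeasurableSpace E]
    [BorelSpace E] (hf : HasStrictFDerivAt f f' p) (hf' : f' ≠ 0) (hp : f p = 0) {d : ℕ}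
    (hd : Module.finrank ℝ E = d + 1) :
    ∃ W ∈ 𝓝 p, μH[d] (W ∩ {x | f x = 0}) < ⊤ := by
  have hr := range_eq_top_of_ne_zero hf'
  let φ := hf.implicitFunction f f' hr (f p)
  let Φ := hf.implicitToOpenPartialHomeomorph f f' hr
  have hφ : HasStrictFDerivAt φ f'.ker.subtypeL 0 := hf.to_implicitFunction hr
  obtain ⟨K, s, hs, hK⟩ := hφ.exists_lipschitzOnWith
  have hker : Module.finrank ℝ f'.ker = d := by
    have h1 := f'.toLinearMap.finrank_range_add_finrank_ker
    have h2 : Module.finrank ℝ (LinearMap.range f'.toLinearMap) = 1 := by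
      rw [show LinearMap.range f'.toLinearMap = ⊤ from hr, finrank_top, Module.finrank_self]
    have h3 : Module.finrank ℝ (LinearMap.ker f'.toLinearMap) = d := by omega
    exact h3
  have hΦ : Tendsto (fun x => (Φ x).2) (𝓝 p) (𝓝 0) := by
    have h1 := (Φ.continuousAt (hf.mem_implicitToOpenPartialHomeomorph_source hr)).tendsto
    have h2 : Φ p = (f p, 0) := hf.implicitToOpenPartialHomeomorph_self hr
    rw [h2] at h1
    exact (continuous_snd.tendsto _).comp h1
  obtain ⟨ε, hε, hball⟩ := Metric.mem_nhds_iff.mp hs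
  -- `φ` is the parametrisation of the single level `f p = 0`, so it recovers `x` only on that
  -- level; the other points are admitted by the second alternative.
  refine ⟨{x | φ (Φ x).2 = x ∨ f x ≠ 0} ∩ {x | (Φ x).2 ∈ Metric.ball 0 ε}, ?_, ?_⟩
  · refine inter_mem ?_ (hΦ.eventually (Metric.ball_mem_nhds _ hε))
    filter_upwards [hf.eq_implicitFunction hr] with x hx
    by_cases h : f x = 0
    · left
      rw [← hp] at h
      rw [h] at hx
      exact hx
    · exact Or.inr h
  · refine (measure_mono (t := φ '' Metric.ball 0 ε) ?_).trans_lt ?_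
    · rintro x ⟨⟨h1, h2⟩, h3⟩
      refine ⟨_, h2, ?_⟩
      rcases h1 with h1 | h1
      · exact h1
      · exact absurd h3 h1
    · refine ((hK.mono hball).hausdorffMeasure_image_le (Nat.cast_nonneg d)).trans_lt ?_
      refine ENNReal.mul_lt_top (by simp) ?_
      rw [← hker]
      exact Metric.isBounded_ball.measure_lt_top

end LevelSets

/-! ### Local defining functions of a regular compact set -/

section DefiningFunctions

open Set Filter

variable {n : ℕ}

theorem reInner_eq_inner (v w : Cn n) : reInner v w = inner ℝ v w := by
  simp [reInner, PiLp.inner_apply]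

theorem norm_sq_eq_reInner (v : Cn n) : reInner v v = ‖v‖ ^ 2 := by
  rw [reInner_eq_inner, real_inner_self_eq_norm_sq]

theorem reInner_add_left (v w x : Cn n) : reInner (v + w) x = reInner v x + reInner w x := by
  simp [reInner]

theorem reInner_add_right (v w x : Cn n) : reInner v (w + x) = reInner v w + reInner v x := by
  simp [reInner]

theorem reInner_smul_left (c : ℝ) (v w : Cn n) : reInner (c • v) w = c * reInner v w := by
  rw [reInner_eq_inner, reInner_eq_inner, real_inner_smul_left]

theorem reInner_smul_right (c : ℝ) (v w : Cn n) : reInner v (c • w) = c * reInner v w := by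
  rw [reInner_eq_inner, reInner_eq_inner, real_inner_smul_right]

theorem reInner_I_smul_left (v w : Cn n) :
    reInner (Complex.I • v) w = -reInner v (Complex.I • w) := by
  simp [reInner]

/-- The vector of `ℂⁿ` representing a real linear form. -/
def rieszVector : (Cn n →L[ℝ] ℝ) →L[ℝ] Cn n :=
  LinearMap.toContinuousLinearMap
    { toFun := fun l => WithLp.toLp 2 fun j =>
        ⟨l (EuclideanSpace.single j 1), l (EuclideanSpace.single j Complex.I)⟩
      map_add' := fun l l' => by ext j; apply Complex.ext <;> simp
      map_smul' := fun c l => by ext j; apply Complex.ext <;> simp }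

theorem grad_eq_rieszVector (ρ : Cn n → ℝ) (z : Cn n) : grad ρ z = rieszVector (fderiv ℝ ρ z) := rfl

theorem reInner_rieszVector (l : Cn n →L[ℝ] ℝ) (v : Cn n) : reInner (rieszVector l) v = l v := by
  have hv : v = ∑ j, ((v j).re • EuclideanSpace.single j (1 : ℂ) +
      (v j).im • EuclideanSpace.single j Complex.I) := by
    ext k
    simp [Pi.single_apply, Complex.ext_iff, apply_ite Complex.re, apply_ite Complex.im]
  conv_rhs => rw [hv]
  simp only [map_sum, map_add, map_smul, smul_eq_mul]
  simp [reInner, PiLp.inner_apply, rieszVector]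

theorem reInner_grad (ρ : Cn n → ℝ) (z v : Cn n) : reInner (grad ρ z) v = fderiv ℝ ρ z v := by
  rw [grad_eq_rieszVector, reInner_rieszVector]

theorem grad_ne_zero_iff {ρ : Cn n → ℝ} {z : Cn n} : grad ρ z ≠ 0 ↔ fderiv ℝ ρ z ≠ 0 := by
  refine not_congr ⟨fun h => ?_, fun h => ?_⟩
  · ext v
    rw [← reInner_grad, h]
    simp [reInner]
  · rw [grad_eq_rieszVector, h, map_zero]

/-- The set `U` is an open set on which `ρ` is a defining function of `A` of class `C²`. -/
structure IsDefiningFunctionOn (A U : Set (Cn n)) (ρ : Cn n → ℝ) : Prop where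
  isOpen : IsOpen U
  contDiffOn : ContDiffOn ℝ 2 ρ U
  fderiv_ne_zero : ∀ z ∈ U, fderiv ℝ ρ z ≠ 0
  mem_interior : ∀ z ∈ U, ρ z < 0 → z ∈ interior A
  eq_zero_iff : ∀ z ∈ U, ρ z = 0 ↔ z ∈ frontier A
  notMem : ∀ z ∈ U, 0 < ρ z → z ∉ A

variable {A U : Set (Cn n)} {ρ : Cn n → ℝ}

theorem IsDefiningFunctionOn.isDefiningFunctionAt (hA : IsClosed A)
    (h : IsDefiningFunctionOn A U ρ) {z : Cn n} (hz : z ∈ U) : IsDefiningFunctionAt A z ρ where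
  contDiffAt := h.contDiffOn.contDiffAt (h.isOpen.mem_nhds hz)
  grad_ne_zero := grad_ne_zero_iff.mpr (h.fderiv_ne_zero z hz)
  neg_of_mem_interior := by
    filter_upwards [h.isOpen.mem_nhds hz] with w hw hwA
    by_contra hn
    rcases (not_lt.mp hn).lt_or_eq with h1 | h1
    · exact h.notMem w hw h1 (interior_subset hwA)
    · exact ((h.eq_zero_iff w hw).mp h1.symm).2 hwA
  eq_zero_of_mem_frontier := by
    filter_upwards [h.isOpen.mem_nhds hz] with w hw hwA using (h.eq_zero_iff w hw).mpr hwA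
  pos_of_notMem := by
    filter_upwards [h.isOpen.mem_nhds hz] with w hw hwA
    by_contra hn
    rcases (not_lt.mp hn).lt_or_eq with h1 | h1
    · exact hwA (interior_subset (h.mem_interior w hw h1))
    · exact hwA (hA.frontier_subset ((h.eq_zero_iff w hw).mp h1))

/-- Both sides of a hypersurface which is the boundary of a closed set. -/
theorem exists_sides_of_mem_frontier (hA : IsClosed A) (hM : IsHypersurface 2 (frontier A))
    {p : Cn n} (hp : p ∈ frontier A) :
    ∃ W : Set (Cn n), IsOpen W ∧ p ∈ W ∧ ∃ f : Cn n → ℝ, ContDiffOn ℝ 2 f W ∧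
      (∀ z ∈ W, fderiv ℝ f z ≠ 0) ∧ (∀ z ∈ W, f z = 0 ↔ z ∈ frontier A) ∧
      (W ∩ {x | 0 < f x} ⊆ interior A ∨ W ∩ {x | 0 < f x} ⊆ Aᶜ) ∧
      (W ∩ {x | f x < 0} ⊆ interior A ∨ W ∩ {x | f x < 0} ⊆ Aᶜ) ∧
      W ∩ {x | f x = 0} ⊆ closure (W ∩ {x | 0 < f x}) ∩ closure (W ∩ {x | f x < 0}) := by
  obtain ⟨U, hU, hpU, f, hf, hf', hfU⟩ := hM p hp
  have hzero : ∀ z ∈ U, f z = 0 ↔ z ∈ frontier A := fun z hz =>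
    ⟨fun h => ((Set.ext_iff.mp hfU z).mpr ⟨hz, h⟩).1,
      fun h => ((Set.ext_iff.mp hfU z).mp ⟨h, hz⟩).2⟩
  have hf2 : ContDiffOn ℝ 2 f U := hf
  have hstrict : HasStrictFDerivAt f (fderiv ℝ f p) p :=
    (hf2.contDiffAt (hU.mem_nhds hpU)).hasStrictFDerivAt two_ne_zero
  obtain ⟨W, hWU, hW, hpW, hpos, hneg, hcl⟩ := exists_isOpen_isPreconnected_sides hstrict
    (hf' p hpU) ((hzero p hpU).mpr hp) (hU.mem_nhds hpU)
  -- Where `f ≠ 0` there are no frontier points, so `S` is covered by the disjoint open sets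
  -- `interior A` and `Aᶜ`.
  have hside : ∀ S ⊆ W, (∀ x ∈ S, f x ≠ 0) → IsPreconnected S → S ⊆ interior A ∨ S ⊆ Aᶜ := by
    intro S hS h0 hc
    refine hc.subset_or_subset isOpen_interior hA.isOpen_compl ?_ ?_
    · exact disjoint_compl_right.mono_left interior_subset
    · intro x hx
      by_cases hxA : x ∈ A
      · left
        by_contra hxi
        exact h0 x hx ((hzero x (hWU (hS hx))).mpr ⟨subset_closure hxA, hxi⟩)
      · exact Or.inr hxA
  exact ⟨W, hW, hpW, f, hf2.mono hWU, fun z hz => hf' z (hWU hz), fun z hz => hzero z (hWU hz),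
    hside _ inter_subset_left (fun x hx => hx.2.ne') hpos,
    hside _ inter_subset_left (fun x hx => hx.2.ne) hneg, hcl⟩

/-- This excludes pieces of `A` that are bare hypersurfaces. If `A` near a frontier point meets its
own interior, then one whole side lies in `A` and the hypersurface lies in the closure of that side.
Hence `closure (interior A)` is open and closed relative to the connected set `A`, and it is
nonempty. -/
theorem IsRegular.subset_closure_interior (hA : IsRegular 2 A) : A ⊆ closure (interior A) := by
  have hAc := hA.isCompact.isClosed
  let u : Set (Cn n) := {x | ∀ᶠ y in 𝓝 x, y ∈ A → y ∈ closure (interior A)}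
  have hu : IsOpen u := isOpen_setOfPred_eventually_nhds
  have key : ∀ p ∈ A, p ∈ closure (interior A) → p ∈ u := by
    intro p hpA hpc
    by_cases hpi : p ∈ interior A
    · filter_upwards [isOpen_interior.mem_nhds hpi] with y hy _ using subset_closure hy
    · obtain ⟨W, hW, hpW, f, -, -, hzero, hpos, hneg, hcl⟩ :=
        exists_sides_of_mem_frontier hAc hA.isHypersurface_frontier ⟨subset_closure hpA, hpi⟩
      obtain ⟨w, hwW, hwA⟩ := mem_closure_iff.mp hpc W hW hpW
      have hw0 : f w ≠ 0 := fun h => ((hzero w hwW).mp h).2 hwA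
      have hex : ∃ S, S ⊆ interior A ∧ W ∩ {x | f x = 0} ⊆ closure S := by
        rcases lt_or_gt_of_ne hw0 with h | h
        · refine ⟨_, hneg.resolve_right fun hn => ?_, hcl.trans inter_subset_right⟩
          exact hn ⟨hwW, h⟩ (interior_subset hwA)
        · refine ⟨_, hpos.resolve_right fun hn => ?_, hcl.trans inter_subset_left⟩
          exact hn ⟨hwW, h⟩ (interior_subset hwA)
      obtain ⟨S, hS, hS'⟩ := hex
      filter_upwards [hW.mem_nhds hpW] with y hy hyA
      by_cases hyi : y ∈ interior A
      · exact subset_closure hyi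
      · exact closure_mono hS (hS' ⟨hy, (hzero y hy).mpr ⟨subset_closure hyA, hyi⟩⟩)
  intro p hp
  by_contra hpn
  have hpu : p ∉ u := fun h => hpn (h.self_of_nhds hp)
  -- The closed sets `closure (interior A)` and `uᶜ` cover `A` and both meet it, so connectedness
  -- gives a common point in `A`, against `key`.
  obtain ⟨q, hqA, hq1, hq2⟩ := isPreconnected_closed_iff.mp hA.isConnected.isPreconnected
    (closure (interior A)) uᶜ isClosed_closure hu.isClosed_compl
    (fun x hx => by
      by_cases hxu : x ∈ u
      · exact Or.inl (hxu.self_of_nhds hx)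
      · exact Or.inr hxu)
    (by
      obtain ⟨q, hq⟩ := hA.interior_nonempty
      exact ⟨q, interior_subset hq, subset_closure hq⟩)
    ⟨p, hp, hpu⟩
  exact hq2 (key q hqA hq1)

/-- If both sides were in the interior, `p` would be interior; if both were outside, `p` would not
be in the closure of the interior. So exactly one side is inside, and `f` or `-f` is a defining
function. -/
theorem IsRegular.exists_isDefiningFunctionOn (hA : IsRegular 2 A) {p : Cn n}
    (hp : p ∈ frontier A) : ∃ (U : Set (Cn n)) (ρ : Cn n → ℝ),
      p ∈ U ∧ IsDefiningFunctionOn A U ρ := by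
  have hAc := hA.isCompact.isClosed
  obtain ⟨W, hW, hpW, f, hf, hf', hzero, hpos, hneg, -⟩ :=
    exists_sides_of_mem_frontier hAc hA.isHypersurface_frontier hp
  rcases hpos with hpos | hpos <;> rcases hneg with hneg | hneg
  · exfalso
    refine hp.2 (mem_interior_iff_mem_nhds.mpr (mem_of_superset (hW.mem_nhds hpW) ?_))
    intro x hx
    rcases lt_trichotomy (f x) 0 with h | h | h
    · exact interior_subset (hneg ⟨hx, h⟩)
    · exact hAc.frontier_subset ((hzero x hx).mp h)
    · exact interior_subset (hpos ⟨hx, h⟩)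
  · refine ⟨W, fun z => -f z, hpW, hW, hf.neg, ?_, ?_, ?_, ?_⟩
    · intro z hz
      rw [fderiv_fun_neg]
      exact neg_ne_zero.mpr (hf' z hz)
    · exact fun z hz h => hpos ⟨hz, neg_lt_zero.mp h⟩
    · exact fun z hz => by rw [neg_eq_zero]; exact hzero z hz
    · exact fun z hz h => hneg ⟨hz, neg_pos.mp h⟩
  · exact ⟨W, f, hpW, hW, hf, hf', fun z hz h => hneg ⟨hz, h⟩, hzero, fun z hz h => hpos ⟨hz, h⟩⟩
  · exfalso
    obtain ⟨w, hwW, hwA⟩ :=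
      mem_closure_iff.mp (hA.subset_closure_interior (hAc.frontier_subset hp)) W hW hpW
    rcases lt_trichotomy (f w) 0 with h | h | h
    · exact hneg ⟨hwW, h⟩ (interior_subset hwA)
    · exact ((hzero w hwW).mp h).2 hwA
    · exact hpos ⟨hwW, h⟩ (interior_subset hwA)

/-! ### Uniqueness of the Gauss map -/

theorem eventually_pos_of_hasDerivAt_pos {g : ℝ → ℝ} {g' : ℝ} (hg : HasDerivAt g g' 0)
    (hg' : 0 < g') (h0 : g 0 = 0) : ∀ᶠ t in 𝓝[>] (0 : ℝ), 0 < g t := by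
  have h1 := hasDerivAt_iff_tendsto_slope.mp hg
  have h2 := (h1.mono_left (nhdsWithin_mono 0
    (fun t (ht : t ∈ Ioi (0 : ℝ)) => ne_of_gt ht))).eventually
    (lt_mem_nhds hg')
  filter_upwards [h2, self_mem_nhdsWithin] with t ht ht0
  rw [slope_def_field, h0, sub_zero, sub_zero] at ht
  exact (div_pos_iff_of_pos_right ht0).mp ht

theorem IsDefiningFunctionAt.mem_tangentConeAt {z : Cn n} (hρ : IsDefiningFunctionAt A z ρ)
    (hz : z ∈ frontier A) {v : Cn n} (hv : fderiv ℝ ρ z v = 0) :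
    v ∈ tangentConeAt ℝ (frontier A) z := by
  refine mem_tangentConeAt_of_apply_eq_zero (hρ.contDiffAt.hasStrictFDerivAt two_ne_zero)
    (grad_ne_zero_iff.mp hρ.grad_ne_zero) (hρ.eq_zero_of_mem_frontier.self_of_nhds hz) ?_ hv
  filter_upwards [hρ.neg_of_mem_interior, hρ.pos_of_notMem] with w h1 h2 h0
  have hwA : w ∈ A := by
    by_contra h
    exact (h2 h).ne' h0
  exact ⟨subset_closure hwA, fun h => (h1 h).ne h0⟩

/-- Both functions vanish on `∂A`, whose tangent cone contains `ker dρ`; hence `ker dρ ⊆ ker dρ'`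
and the gradients are proportional. The factor is positive because both functions are negative
inside `A`. -/
theorem IsDefiningFunctionAt.normalize_grad_eq {z : Cn n} {ρ' : Cn n → ℝ}
    (hρ : IsDefiningFunctionAt A z ρ) (hρ' : IsDefiningFunctionAt A z ρ') (hz : z ∈ frontier A) :
    (‖grad ρ' z‖⁻¹ : ℝ) • grad ρ' z = (‖grad ρ z‖⁻¹ : ℝ) • grad ρ z := by
  have hd : DifferentiableAt ℝ ρ z := hρ.contDiffAt.differentiableAt two_ne_zero
  have hd' : DifferentiableAt ℝ ρ' z := hρ'.contDiffAt.differentiableAt two_ne_zero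
  have h0 : ρ z = 0 := hρ.eq_zero_of_mem_frontier.self_of_nhds hz
  have h0' : ρ' z = 0 := hρ'.eq_zero_of_mem_frontier.self_of_nhds hz
  have hker : ∀ v, fderiv ℝ ρ z v = 0 → fderiv ℝ ρ' z v = 0 := by
    intro v hv
    have h1 : HasFDerivWithinAt ρ' (0 : Cn n →L[ℝ] ℝ) (frontier A) z := by
      refine (hasFDerivWithinAt_const (0 : ℝ) z (frontier A)).congr_of_eventuallyEq ?_ h0'
      filter_upwards [mem_nhdsWithin_of_mem_nhds hρ'.eq_zero_of_mem_frontier,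
        self_mem_nhdsWithin] with w h1 h2 using h1 h2
    exact hd'.hasFDerivAt.hasFDerivWithinAt.unique_on h1 (hρ.mem_tangentConeAt hz hv)
  set a := grad ρ z with ha
  set a' := grad ρ' z with ha'
  have han : 0 < ‖a‖ := norm_pos_iff.mpr hρ.grad_ne_zero
  obtain ⟨c, hc⟩ : ∃ c : ℝ, a' = c • a := by
    -- The residual of the projection of `a'` on `a` is orthogonal to `a`, so it lies in `ker dρ ⊆
    -- ker dρ'`; being orthogonal to `a'` as well, it has norm zero.
    refine ⟨reInner a a' / ‖a‖ ^ 2, ?_⟩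
    have h1 : reInner a (a' + (-(reInner a a' / ‖a‖ ^ 2)) • a) = 0 := by
      rw [reInner_add_right, reInner_smul_right, norm_sq_eq_reInner]
      field_simp
      ring
    have h2 : reInner a' (a' + (-(reInner a a' / ‖a‖ ^ 2)) • a) = 0 := by
      rw [ha', reInner_grad]
      apply hker
      rw [← reInner_grad]
      exact h1
    have h3 : ‖a' + (-(reInner a a' / ‖a‖ ^ 2)) • a‖ ^ 2 = 0 := by
      rw [← norm_sq_eq_reInner, reInner_add_left, h2, reInner_smul_left, h1, mul_zero, add_zero]
    have h4 := norm_eq_zero.mp (pow_eq_zero_iff two_ne_zero |>.mp h3)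
    rw [neg_smul, ← sub_eq_add_neg] at h4
    exact sub_eq_zero.mp h4
  have hc0 : c ≠ 0 := by
    rintro rfl
    exact hρ'.grad_ne_zero (by rw [← ha', hc, zero_smul])
  have hcpos : 0 < c := by
    -- If `c < 0`, then along `-a` and for small positive time `ρ` is negative, so the point is
    -- interior, while `ρ'` is positive there.
    by_contra hneg
    have hcneg : c < 0 := lt_of_le_of_ne (not_lt.mp hneg) hc0
    have hline : HasDerivAt (fun t : ℝ => z + t • (-a)) (-a) 0 := by
      simpa using ((hasDerivAt_id (0 : ℝ)).smul_const (-a)).const_add z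
    have hz0 : z + (0 : ℝ) • (-a) = z := by simp
    have e1 : HasDerivAt (fun t : ℝ => ρ (z + t • (-a))) (fderiv ℝ ρ z (-a)) 0 :=
      HasFDerivAt.comp_hasDerivAt (0 : ℝ) (by rw [hz0]; exact hd.hasFDerivAt) hline
    have e2 : HasDerivAt (fun t : ℝ => ρ' (z + t • (-a))) (fderiv ℝ ρ' z (-a)) 0 :=
      HasFDerivAt.comp_hasDerivAt (0 : ℝ) (by rw [hz0]; exact hd'.hasFDerivAt) hline
    have v1 : fderiv ℝ ρ z (-a) = -‖a‖ ^ 2 := by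
      rw [map_neg, ← reInner_grad, ← ha, norm_sq_eq_reInner]
    have v2 : fderiv ℝ ρ' z (-a) = -c * ‖a‖ ^ 2 := by
      rw [map_neg, ← reInner_grad, ← ha', hc, reInner_smul_left, norm_sq_eq_reInner]
      ring
    have p1 := eventually_pos_of_hasDerivAt_pos e1.neg
      (by rw [v1]; nlinarith) (by simp [h0])
    have p2 := eventually_pos_of_hasDerivAt_pos e2 (by rw [v2]; nlinarith [sq_pos_of_pos han])
      (by simp [h0'])
    have hcont : Tendsto (fun t : ℝ => z + t • (-a)) (𝓝[>] 0) (𝓝 z) := by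
      have := hline.continuousAt.tendsto
      rw [hz0] at this
      exact this.mono_left nhdsWithin_le_nhds
    obtain ⟨t, q1, q2, q3, q4, q5⟩ := (p1.and (p2.and
      ((hcont.eventually hρ.eq_zero_of_mem_frontier).and
        ((hcont.eventually hρ.pos_of_notMem).and
          (hcont.eventually hρ'.neg_of_mem_interior))))).exists
    have r1 : ρ (z + t • (-a)) < 0 := neg_pos.mp q1
    have hA : z + t • (-a) ∈ A := by
      by_contra h
      exact (q4 h).not_gt r1
    have hi : z + t • (-a) ∈ interior A := by
      by_contra h
      exact r1.ne (q3 ⟨subset_closure hA, h⟩)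
    exact (q5 hi).not_gt q2
  rw [hc, norm_smul, Real.norm_of_nonneg hcpos.le, smul_smul]
  congr 1
  field_simp

theorem IsDefiningFunctionAt.gaussMap_eq {z : Cn n} (hρ : IsDefiningFunctionAt A z ρ)
    (hz : z ∈ frontier A) : gaussMap A z = (‖grad ρ z‖⁻¹ : ℝ) • grad ρ z := by
  have h : ∃ ρ, IsDefiningFunctionAt A z ρ := ⟨ρ, hρ⟩
  rw [gaussMap, dif_pos h]
  exact hρ.normalize_grad_eq h.choose_spec hz

theorem IsDefiningFunctionAt.norm_gaussMap {z : Cn n} (hρ : IsDefiningFunctionAt A z ρ)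
    (hz : z ∈ frontier A) : ‖gaussMap A z‖ = 1 := by
  rw [hρ.gaussMap_eq hz, norm_smul, norm_inv, norm_norm,
    inv_mul_cancel₀ (norm_ne_zero_iff.mpr hρ.grad_ne_zero)]

end DefiningFunctions

/-! ### The second quadratic form and the exterior derivative of `α` -/

section SecondForm

open Set Filter

variable {n : ℕ} {A U : Set (Cn n)} {ρ : Cn n → ℝ} {z : Cn n}

/-- The normalised gradient of `ρ`. -/
def normalField (ρ : Cn n → ℝ) (w : Cn n) : Cn n := (‖grad ρ w‖⁻¹ : ℝ) • grad ρ w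

theorem IsDefiningFunctionOn.contDiffOn_grad (h : IsDefiningFunctionOn A U ρ) :
    ContDiffOn ℝ 1 (grad ρ) U :=
  rieszVector.contDiff.comp_contDiffOn
    (h.contDiffOn.fderiv_of_isOpen h.isOpen (by norm_num [one_add_one_eq_two]))

theorem IsDefiningFunctionOn.contDiffOn_normalField (h : IsDefiningFunctionOn A U ρ) :
    ContDiffOn ℝ 1 (normalField ρ) U := by
  have h0 : ∀ w ∈ U, grad ρ w ≠ 0 := fun w hw => grad_ne_zero_iff.mpr (h.fderiv_ne_zero w hw)
  exact ((h.contDiffOn_grad.norm ℝ h0).inv fun w hw => norm_ne_zero_iff.mpr (h0 w hw)).smul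
    h.contDiffOn_grad

theorem IsDefiningFunctionOn.gaussMap_eq (hA : IsClosed A) (h : IsDefiningFunctionOn A U ρ)
    (hzU : z ∈ U) (hz : z ∈ frontier A) : gaussMap A z = normalField ρ z :=
  (h.isDefiningFunctionAt hA hzU).gaussMap_eq hz

theorem IsDefiningFunctionOn.hasFDerivWithinAt_gaussMap (hA : IsClosed A)
    (h : IsDefiningFunctionOn A U ρ) (hzU : z ∈ U) (hz : z ∈ frontier A) :
    HasFDerivWithinAt (gaussMap A) (fderiv ℝ (normalField ρ) z) (frontier A) z := by
  have h1 : DifferentiableAt ℝ (normalField ρ) z :=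
    (h.contDiffOn_normalField.contDiffAt (h.isOpen.mem_nhds hzU)).differentiableAt one_ne_zero
  refine h1.hasFDerivAt.hasFDerivWithinAt.congr_of_eventuallyEq ?_ (h.gaussMap_eq hA hzU hz)
  filter_upwards [mem_nhdsWithin_of_mem_nhds (h.isOpen.mem_nhds hzU), self_mem_nhdsWithin]
    with w hw hwA using h.gaussMap_eq hA hw hwA

theorem IsDefiningFunctionOn.fderiv_apply_eq_zero (hA : IsClosed A)
    (h : IsDefiningFunctionOn A U ρ) (hzU : z ∈ U) (hz : z ∈ frontier A) {v : Cn n}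
    (hv : v ∈ tangentHyperplane A z) : fderiv ℝ ρ z v = 0 := by
  have hv' : reInner (gaussMap A z) v = 0 := hv
  rw [h.gaussMap_eq hA hzU hz, normalField, reInner_smul_left, reInner_grad] at hv'
  exact (mul_eq_zero.mp hv').resolve_left
    (inv_ne_zero (norm_ne_zero_iff.mpr (grad_ne_zero_iff.mpr (h.fderiv_ne_zero z hzU))))

theorem IsDefiningFunctionOn.mem_tangentConeAt (hA : IsClosed A)
    (h : IsDefiningFunctionOn A U ρ) (hzU : z ∈ U) (hz : z ∈ frontier A) {v : Cn n}
    (hv : v ∈ tangentHyperplane A z) : v ∈ tangentConeAt ℝ (frontier A) z :=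
  (h.isDefiningFunctionAt hA hzU).mem_tangentConeAt hz (h.fderiv_apply_eq_zero hA hzU hz hv)

/-- Derivatives within the hypersurface are not unique, but any two agree on the tangent cone, which
contains the tangent hyperplane. -/
theorem IsDefiningFunctionOn.fderivWithin_gaussMap_apply (hA : IsClosed A)
    (h : IsDefiningFunctionOn A U ρ) (hzU : z ∈ U) (hz : z ∈ frontier A) {v : Cn n}
    (hv : v ∈ tangentHyperplane A z) :
    fderivWithin ℝ (gaussMap A) (frontier A) z v = fderiv ℝ (normalField ρ) z v := by
  have h1 := h.hasFDerivWithinAt_gaussMap hA hzU hz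
  exact h1.differentiableWithinAt.hasFDerivWithinAt.unique_on h1
    (h.mem_tangentConeAt hA hzU hz hv)

/-- Differentiating the factor `‖grad ρ‖⁻¹` yields a multiple of `grad ρ`, which is orthogonal to
`η`; only the Hessian term survives. Symmetry of the second quadratic form is read off from this. -/
theorem IsDefiningFunctionOn.reInner_fderiv_normalField (h : IsDefiningFunctionOn A U ρ)
    (hzU : z ∈ U) (ζ : Cn n) {η : Cn n} (hη : fderiv ℝ ρ z η = 0) :
    reInner (fderiv ℝ (normalField ρ) z ζ) η =
      ‖grad ρ z‖⁻¹ * fderiv ℝ (fderiv ℝ ρ) z ζ η := by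
  have hU := h.isOpen.mem_nhds hzU
  have h0 : grad ρ z ≠ 0 := grad_ne_zero_iff.mpr (h.fderiv_ne_zero z hzU)
  have d1 : DifferentiableAt ℝ (fderiv ℝ ρ) z :=
    ((h.contDiffOn.fderiv_of_isOpen (m := 1) h.isOpen
      (by norm_num [one_add_one_eq_two])).contDiffAt hU).differentiableAt one_ne_zero
  have d2 : HasFDerivAt (grad ρ) (rieszVector.comp (fderiv ℝ (fderiv ℝ ρ) z)) z :=
    rieszVector.hasFDerivAt.comp z d1.hasFDerivAt
  have d3 : DifferentiableAt ℝ (fun w => ‖grad ρ w‖⁻¹) z :=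
    (d2.differentiableAt.norm ℝ h0).inv (norm_ne_zero_iff.mpr h0)
  have d4 : HasFDerivAt (normalField ρ) _ z := d3.hasFDerivAt.smul d2
  rw [d4.fderiv]
  simp [reInner_add_left, reInner_smul_left, reInner_grad, hη, reInner_rieszVector]

theorem IsDefiningFunctionOn.secondForm_comm (hA : IsClosed A)
    (h : IsDefiningFunctionOn A U ρ) (hzU : z ∈ U) (hz : z ∈ frontier A) {ζ η : Cn n}
    (hζ : ζ ∈ tangentHyperplane A z) (hη : η ∈ tangentHyperplane A z) :
    secondForm A z ζ η = secondForm A z η ζ := by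
  have hζ' := h.fderiv_apply_eq_zero hA hzU hz hζ
  have hη' := h.fderiv_apply_eq_zero hA hzU hz hη
  rw [secondForm, secondForm, h.fderivWithin_gaussMap_apply hA hzU hz hζ,
    h.fderivWithin_gaussMap_apply hA hzU hz hη, h.reInner_fderiv_normalField hzU ζ hη',
    h.reInner_fderiv_normalField hzU η hζ']
  have hs : IsSymmSndFDerivAt ℝ ρ z :=
    (h.contDiffOn.contDiffAt (h.isOpen.mem_nhds hzU)).isSymmSndFDerivAt (by simp)
  rw [hs.eq ζ η]

/-- The 1-form `ζ ↦ Re ⟨ζ, i ν⟩` as a linear function of `ν`. -/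
def rotatedForm (n : ℕ) : Cn n →L[ℝ] (Cn n [⋀^Fin 1]→L[ℝ] ℝ) :=
  LinearMap.toContinuousLinearMap
    { toFun := fun w => ContinuousAlternatingMap.ofSubsingleton ℝ (Cn n) ℝ (0 : Fin 1)
        (Complex.reCLM.comp ((innerSL ℂ (Complex.I • w)).restrictScalars ℝ))
      map_add' := fun v w => by ext x; simp
      map_smul' := fun c w => by
        ext x
        have : Complex.I • c • w = c • Complex.I • w := smul_comm _ _ _
        change reInner (Complex.I • c • w) (x 0) = c * reInner (Complex.I • w) (x 0)
        rw [this, reInner_smul_left] }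

theorem rotatedForm_apply (w : Cn n) (v : Fin 1 → Cn n) :
    rotatedForm n w v = reInner (Complex.I • w) (v 0) := rfl

/-- `α` is the constant linear map `rotatedForm` applied to `ν`, so `dα(ζ, η) = Re ⟨i dν(ζ), η⟩ - Re
⟨i dν(η), ζ⟩`; moving `i` to the other argument changes the sign. -/
theorem IsDefiningFunctionOn.dAlpha_apply (hA : IsClosed A)
    (h : IsDefiningFunctionOn A U ρ) (hzU : z ∈ U) (hz : z ∈ frontier A) {ζ η : Cn n}
    (hζ : ζ ∈ tangentHyperplane A z) (hη : η ∈ tangentHyperplane A z) :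
    dAlpha A z ![ζ, η] = secondForm A z η (Complex.I • ζ) - secondForm A z ζ (Complex.I • η) := by
  have h1 := h.hasFDerivWithinAt_gaussMap hA hzU hz
  have h2 : HasFDerivWithinAt (alpha A) ((rotatedForm n).comp (fderiv ℝ (normalField ρ) z))
      (frontier A) z := (rotatedForm n).hasFDerivAt.comp_hasFDerivWithinAt z h1
  have h3 : ∀ v ∈ tangentHyperplane A z, fderivWithin ℝ (alpha A) (frontier A) z v =
      rotatedForm n (fderivWithin ℝ (gaussMap A) (frontier A) z v) := by
    intro v hv
    rw [h.fderivWithin_gaussMap_apply hA hzU hz hv]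
    exact h2.differentiableWithinAt.hasFDerivWithinAt.unique_on h2
      (h.mem_tangentConeAt hA hzU hz hv)
  rw [dAlpha, extDerivWithin, ContinuousAlternatingMap.alternatizeUncurryFin_apply]
  rw [Fin.sum_univ_two]
  simp [h3 ζ hζ, h3 η hη, rotatedForm_apply, secondForm, reInner_I_smul_left, Fin.removeNth]
  ring

end SecondForm

/-! ### Hermitian symmetry and positivity of the Levi form -/

section LeviForm

variable {n : ℕ} {A : Set (Cn n)} {z : Cn n}

/-- The second quadratic form of `∂A` at `z` is symmetric. -/
def IsSymmSecondForm (A : Set (Cn n)) (z : Cn n) : Prop :=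
  ∀ ζ ∈ tangentHyperplane A z, ∀ η ∈ tangentHyperplane A z,
    secondForm A z ζ η = secondForm A z η ζ

theorem secondForm_add_left (A : Set (Cn n)) (z ζ ζ' η : Cn n) :
    secondForm A z (ζ + ζ') η = secondForm A z ζ η + secondForm A z ζ' η := by
  simp [secondForm, reInner_add_left]

theorem secondForm_smul_left (A : Set (Cn n)) (z : Cn n) (c : ℝ) (ζ η : Cn n) :
    secondForm A z (c • ζ) η = c * secondForm A z ζ η := by
  rw [secondForm, map_smul, reInner_smul_left, secondForm]

theorem secondForm_neg_left (A : Set (Cn n)) (z ζ η : Cn n) :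
    secondForm A z (-ζ) η = -secondForm A z ζ η := by
  simpa using secondForm_smul_left A z (-1) ζ η

theorem secondForm_neg_right (A : Set (Cn n)) (z ζ η : Cn n) :
    secondForm A z ζ (-η) = -secondForm A z ζ η := by
  have := reInner_smul_right (-1) (fderivWithin ℝ (gaussMap A) (frontier A) z ζ) η
  simpa [secondForm] using this

theorem I_smul_I_smul (ζ : Cn n) : Complex.I • Complex.I • ζ = -ζ := by
  rw [smul_smul, Complex.I_mul_I, neg_one_smul]

theorem mem_tangentHyperplane_of_mem {ζ : Cn n} (h : ζ ∈ complexTangentSpace A z) :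
    ζ ∈ tangentHyperplane A z := ((mem_complexTangentSpace_iff A z ζ).mp h).1

theorem secondFormC_add_left (ζ ζ' η : Cn n) :
    secondFormC A z (ζ + ζ') η = secondFormC A z ζ η + secondFormC A z ζ' η := by
  simp only [secondFormC, smul_add, secondForm_add_left]
  ring

theorem secondFormC_smul_left (c : ℝ) (ζ η : Cn n) :
    secondFormC A z (c • ζ) η = c * secondFormC A z ζ η := by
  have : Complex.I • c • ζ = c • Complex.I • ζ := smul_comm _ _ _
  simp only [secondFormC, this, secondForm_smul_left]
  ring

theorem secondFormC_I_left (ζ η : Cn n) :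
    secondFormC A z (Complex.I • ζ) η = -secondFormC A z ζ (Complex.I • η) := by
  simp only [secondFormC, I_smul_I_smul, secondForm_neg_left, secondForm_neg_right]
  ring

theorem leviForm_add_left (ζ ζ' η : Cn n) :
    leviForm A z (ζ + ζ') η = leviForm A z ζ η + leviForm A z ζ' η := by
  simp only [leviForm, secondFormC_add_left]
  push_cast
  ring

theorem leviForm_real_smul_left (c : ℝ) (ζ η : Cn n) :
    leviForm A z (c • ζ) η = c * leviForm A z ζ η := by
  simp only [leviForm, secondFormC_smul_left]
  push_cast
  ring

theorem secondFormC_I_I (ζ η : Cn n) :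
    secondFormC A z (Complex.I • ζ) (Complex.I • η) = secondFormC A z ζ η := by
  simp only [secondFormC, I_smul_I_smul, secondForm_neg_left, secondForm_neg_right, neg_neg]
  ring

theorem leviForm_I_left (ζ η : Cn n) :
    leviForm A z (Complex.I • ζ) η = Complex.I * leviForm A z ζ η := by
  simp only [leviForm, secondFormC_I_left ζ η, secondFormC_I_I]
  push_cast
  linear_combination -(secondFormC A z ζ (Complex.I • η) : ℂ) * Complex.I_mul_I

theorem leviForm_smul_left (c : ℂ) (ζ η : Cn n) :
    leviForm A z (c • ζ) η = c * leviForm A z ζ η := by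
  conv_lhs => rw [← Complex.re_add_im c, add_smul, mul_smul, Complex.coe_smul, Complex.coe_smul]
  rw [leviForm_add_left, leviForm_real_smul_left, leviForm_real_smul_left, leviForm_I_left]
  conv_rhs => rw [← Complex.re_add_im c]
  ring

variable {ζ η : Cn n}

theorem IsSymmSecondForm.secondFormC_comm (hs : IsSymmSecondForm A z)
    (hζ : ζ ∈ complexTangentSpace A z) (hη : η ∈ complexTangentSpace A z) :
    secondFormC A z ζ η = secondFormC A z η ζ := by
  rw [mem_complexTangentSpace_iff] at hζ hη
  rw [secondFormC, secondFormC, hs ζ hζ.1 η hη.1, hs _ hζ.2 _ hη.2]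

theorem IsSymmSecondForm.conj_leviForm (hs : IsSymmSecondForm A z)
    (hζ : ζ ∈ complexTangentSpace A z) (hη : η ∈ complexTangentSpace A z) :
    starRingEnd ℂ (leviForm A z η ζ) = leviForm A z ζ η := by
  have h1 : secondFormC A z ζ (Complex.I • η) = -secondFormC A z η (Complex.I • ζ) := by
    rw [hs.secondFormC_comm hζ (Submodule.smul_mem _ _ hη), secondFormC_I_left]
  rw [leviForm, leviForm, hs.secondFormC_comm hζ hη, h1]
  simp

/-- The Levi form as a sesquilinear form on the complex tangent space. -/
def IsSymmSecondForm.sesqForm (hs : IsSymmSecondForm A z) :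
    complexTangentSpace A z →ₗ[ℂ] complexTangentSpace A z →ₗ⋆[ℂ] ℂ :=
  LinearMap.mk₂'ₛₗ (RingHom.id ℂ) (starRingEnd ℂ) (fun ζ η => leviForm A z ζ η)
    (fun ζ ζ' η => leviForm_add_left _ _ _)
    (fun c ζ η => leviForm_smul_left _ _ _)
    (fun ζ η η' => by
      rw [← hs.conj_leviForm ζ.2 (η + η').2, Submodule.coe_add, leviForm_add_left, map_add,
        hs.conj_leviForm ζ.2 η.2, hs.conj_leviForm ζ.2 η'.2])
    (fun c ζ η => by
      rw [← hs.conj_leviForm ζ.2 (c • η).2, Submodule.coe_smul, leviForm_smul_left, map_mul,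
        hs.conj_leviForm ζ.2 η.2, smul_eq_mul])

theorem IsSymmSecondForm.sesqForm_apply (hs : IsSymmSecondForm A z)
    (ζ η : complexTangentSpace A z) : hs.sesqForm ζ η = leviForm A z ζ η := rfl

theorem IsSymmSecondForm.leviForm_sum {κ : Type*} [Fintype κ] (hs : IsSymmSecondForm A z)
    (b : κ → complexTangentSpace A z) (x y : κ → ℂ) :
    leviForm A z (∑ j, x j • b j : complexTangentSpace A z)
      (∑ j, y j • b j : complexTangentSpace A z) =
      ∑ j, ∑ k, x j * leviForm A z (b j) (b k) * starRingEnd ℂ (y k) := by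
  rw [← hs.sesqForm_apply]
  simp only [map_sum, LinearMap.sum_apply, map_smul, LinearMap.smul_apply, smul_eq_mul,
    LinearMap.map_smulₛₗ, hs.sesqForm_apply]
  conv_rhs => rw [Finset.sum_comm]
  refine Finset.sum_congr rfl fun j _ => ?_
  rw [Finset.mul_sum]
  refine Finset.sum_congr rfl fun k _ => by ring

open scoped ComplexOrder in
theorem IsSymmSecondForm.posSemidef_leviMatrix (hs : IsSymmSecondForm A z)
    (h : ∀ ζ ∈ complexTangentSpace A z, 0 ≤ (leviForm A z ζ ζ).re) :
    (leviMatrix A z).PosSemidef := by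
  refine Matrix.PosSemidef.of_dotProduct_mulVec_nonneg ?_ fun x => ?_
  · ext j k
    exact hs.conj_leviForm (Subtype.property _) (Subtype.property _)
  -- The Levi form is linear in its first argument, so `x* M x` is its value at the vector with the
  -- conjugate coordinates `conj (x j)`.
  · have h1 := hs.leviForm_sum (stdOrthonormalBasis ℂ (complexTangentSpace A z))
      (fun j => starRingEnd ℂ (x j)) (fun j => starRingEnd ℂ (x j))
    have h2 : star x ⬝ᵥ (leviMatrix A z).mulVec x =
        leviForm A z (∑ j, starRingEnd ℂ (x j) • stdOrthonormalBasis ℂ (complexTangentSpace A z) j :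
          complexTangentSpace A z)
        (∑ j, starRingEnd ℂ (x j) • stdOrthonormalBasis ℂ (complexTangentSpace A z) j :
          complexTangentSpace A z) := by
      rw [h1]
      simp [dotProduct, Matrix.mulVec, leviMatrix, Finset.mul_sum, mul_assoc]
    rw [h2, Complex.nonneg_iff]
    refine ⟨h _ (Subtype.property _), ?_⟩
    have h3 := congrArg Complex.im (hs.conj_leviForm (Subtype.property
      (∑ j, starRingEnd ℂ (x j) • stdOrthonormalBasis ℂ (complexTangentSpace A z) j))
      (Subtype.property
      (∑ j, starRingEnd ℂ (x j) • stdOrthonormalBasis ℂ (complexTangentSpace A z) j)))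
    rw [Complex.conj_im] at h3
    linarith

open scoped ComplexOrder in
theorem IsSymmSecondForm.leviDet_nonneg (hs : IsSymmSecondForm A z)
    (h : ∀ ζ ∈ complexTangentSpace A z, 0 ≤ (leviForm A z ζ ζ).re) : 0 ≤ leviDet A z :=
  (Complex.nonneg_iff.mp (hs.posSemidef_leviMatrix h).det_nonneg).1

end LeviForm

/-! ### The density of `α ∧ (dα)^(n-1)` -/

section Density

variable {m : ℕ} {A : Set (Cn (m + 1))} {z : Cn (m + 1)}

theorem finrank_complexTangentSpace (hν : ‖gaussMap A z‖ = 1) :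
    Module.finrank ℂ (complexTangentSpace A z) = m := by
  have : Fact (Module.finrank ℂ (Cn (m + 1)) = m + 1) := ⟨finrank_euclideanSpace_fin⟩
  exact Submodule.finrank_orthogonal_span_singleton (norm_ne_zero_iff.mp (by rw [hν]; norm_num))

/-- An orthonormal basis of `T^ℂ_z ∂A`, extended by the normal. -/
theorem exists_orthonormalBasis_cons (hν : ‖gaussMap A z‖ = 1)
    (b : OrthonormalBasis (Fin m) ℂ (complexTangentSpace A z)) :
    ∃ u : OrthonormalBasis (Fin (m + 1)) ℂ (Cn (m + 1)),
      u 0 = gaussMap A z ∧ ∀ j : Fin m, u j.succ = b j := by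
  let v : Fin (m + 1) → Cn (m + 1) := Fin.cons (gaussMap A z) fun j => (b j : Cn (m + 1))
  have hperp : ∀ j, inner ℂ (gaussMap A z) (b j : Cn (m + 1)) = 0 := fun j =>
    Submodule.mem_orthogonal_singleton_iff_inner_right.mp (b j).2
  have hv : Orthonormal ℂ v := by
    rw [orthonormal_iff_ite]
    intro i j
    refine Fin.cases ?_ (fun i => ?_) i <;> refine Fin.cases ?_ (fun j => ?_) j
    · simp [v, inner_self_eq_norm_sq_to_K, hν]
    · simp [v, hperp, (Fin.succ_ne_zero j).symm]
    · have : inner ℂ (b i : Cn (m + 1)) (gaussMap A z) = 0 := by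
        rw [← inner_conj_symm, hperp, map_zero]
      simp [v, this]
    · have := orthonormal_iff_ite.mp b.orthonormal i j
      simpa [v] using this
  have hcard : Fintype.card (Fin (m + 1)) = Module.finrank ℂ (Cn (m + 1)) := by simp
  let B := basisOfOrthonormalOfCardEqFinrank hv hcard
  have hB : ⇑B = v := coe_basisOfOrthonormalOfCardEqFinrank hv hcard
  refine ⟨B.toOrthonormalBasis (by rw [hB]; exact hv), ?_, fun j => ?_⟩
  · rw [Module.Basis.coe_toOrthonormalBasis, hB]
    rfl
  · rw [Module.Basis.coe_toOrthonormalBasis, hB]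
    rfl

/-- The matrix of the Levi form in an orthonormal basis. -/
def leviMatrixOf (A : Set (Cn (m + 1))) (z : Cn (m + 1))
    (b : OrthonormalBasis (Fin m) ℂ (complexTangentSpace A z)) : Matrix (Fin m) (Fin m) ℂ :=
  Matrix.of fun j k => leviForm A z (b j) (b k)

theorem exists_orthonormalBasis_leviDet (hν : ‖gaussMap A z‖ = 1) :
    ∃ b : OrthonormalBasis (Fin m) ℂ (complexTangentSpace A z),
      leviDet A z = (leviMatrixOf A z b).det.re := by
  refine ⟨(stdOrthonormalBasis ℂ (complexTangentSpace A z)).reindex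
    (finCongr (finrank_complexTangentSpace hν)), ?_⟩
  rw [leviDet, ← Matrix.det_reindex_self (finCongr (finrank_complexTangentSpace hν))]
  congr 2
  ext j k
  simp [leviMatrixOf, leviMatrix]

/-- The pointwise identity behind the theorem: on the frame `iν, u₁, iu₁, …` the form `α` singles
out `iν`, and on the remaining vectors `dα(ζ, η) = i (ℒ(ζ, η) - ℒ(η, ζ))`, so
`wedgePow_of_hermitian` applies to the Levi matrix. -/
theorem formDensity_alphaWedge [NeZero (m + 1)] {U : Set (Cn (m + 1))} {ρ : Cn (m + 1) → ℝ}
    (hA : IsClosed A) (h : IsDefiningFunctionOn A U ρ) (hzU : z ∈ U) (hz : z ∈ frontier A) :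
    formDensity A z (alphaWedge A z) = 2 ^ m * m.factorial * leviDet A z := by
  have hν : ‖gaussMap A z‖ = 1 := (h.isDefiningFunctionAt hA hzU).norm_gaussMap hz
  have hs : IsSymmSecondForm A z := fun ζ hζ η hη => h.secondForm_comm hA hzU hz hζ hη
  obtain ⟨b, hb⟩ := exists_orthonormalBasis_leviDet hν
  obtain ⟨u, hu0, hu⟩ := exists_orthonormalBasis_cons hν b
  have hmem : ∀ p : Fin m × Fin 2, realFrame (u ∘ Fin.succ) p ∈ complexTangentSpace A z := by
    intro p
    rw [realFrame, Function.comp_apply, hu]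
    exact Submodule.smul_mem _ _ (b p.1).2
  have halpha : ∀ v : Fin 1 → Cn (m + 1), (alpha A z).toAlternatingMap v =
      reInner (Complex.I • gaussMap A z) (v 0) := fun v => rfl
  rw [formDensity_eq A z u hu0, alphaWedge]
  refine (wedge_apply_of_eq_zero (p := 2 * m) _ _ _ ?_).trans ?_
  · intro j
    obtain ⟨p, rfl⟩ := (pairEquiv m).surjective j
    rw [tangentFrame_natAdd, halpha, reInner_I_smul_left, neg_eq_zero]
    exact ((mem_complexTangentSpace_iff A z _).mp (hmem p)).2
  · have h1 : (fun j => tangentFrame u (Fin.natAdd 1 j)) =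
        realFrame (u ∘ Fin.succ) ∘ (pairEquiv m).symm := by
      funext j
      obtain ⟨p, rfl⟩ := (pairEquiv m).surjective j
      rw [tangentFrame_natAdd]
      simp
    rw [h1, tangentFrame_zero, halpha, hu0, norm_sq_eq_reInner, norm_smul, hν]
    have h2 := wedgePow_of_hermitian (dAlpha A z).toAlternatingMap
      (realFrame (u ∘ Fin.succ)) (leviMatrixOf A z b) (by
        intro a a'
        have e1 : ∀ a a' : Fin m × Fin 2, leviForm A z (realFrame (u ∘ Fin.succ) a)
            (realFrame (u ∘ Fin.succ) a') = leviMatrixOf A z b a.1 a'.1 *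
              (unitFactor a.2 * starRingEnd ℂ (unitFactor a'.2)) := by
          intro a a'
          -- `leviForm_sum` uses one family for both arguments. A two-element index set, with
          -- coefficients supported on different elements, lets the arguments be multiples of `b
          -- a.1` and `b a'.1`.
          have := hs.leviForm_sum
            (fun i : Fin 1 ⊕ Fin 1 => Sum.elim (fun _ => b a.1) (fun _ => b a'.1) i)
            (Sum.elim (fun _ => unitFactor a.2) 0) (Sum.elim 0 (fun _ => unitFactor a'.2))
          simp only [Fintype.sum_sum_type, Finset.univ_unique, Finset.sum_singleton, Sum.elim_inl,
            Sum.elim_inr, Pi.zero_apply, zero_smul, add_zero, zero_add, zero_mul, map_zero,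
            mul_zero, Submodule.coe_smul] at this
          rw [realFrame, realFrame, Function.comp_apply, Function.comp_apply, hu, hu, this]
          simp only [leviMatrixOf, Matrix.of_apply]
          ring
        rw [← e1, ← e1, ← hs.conj_leviForm (hmem a) (hmem a')]
        have e2 := h.dAlpha_apply hA hzU hz (mem_tangentHyperplane_of_mem (hmem a))
          (mem_tangentHyperplane_of_mem (hmem a'))
        rw [ContinuousAlternatingMap.coe_toAlternatingMap, e2]
        have m1 := (mem_complexTangentSpace_iff A z _).mp (hmem a)
        have m2 := (mem_complexTangentSpace_iff A z _).mp (hmem a')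
        apply Complex.ext
        · simp only [leviForm, secondFormC, I_smul_I_smul, secondForm_neg_right]
          rw [hs _ m1.1 _ m2.2]
          simp
          ring
        · simp)
    have h3 := congrArg Complex.re h2
    rw [Complex.ofReal_re] at h3
    -- The factor `(‖Complex.I‖ * 1) ^ 2` is `α(iν) = ‖iν‖² = 1`.
    refine (congrArg (fun t => (‖Complex.I‖ * 1) ^ 2 * t) h3).trans ?_
    rw [hb, show (2 : ℂ) ^ m * (m.factorial : ℂ) = ((2 ^ m * m.factorial : ℝ) : ℂ)
        by push_cast; ring,
      Complex.re_ofReal_mul]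
    simp

theorem formDensity_smul_boundaryVolForm [NeZero (m + 1)] (hν : ‖gaussMap A z‖ = 1) (c : ℝ) :
    formDensity A z (c • boundaryVolForm A z) = c := by
  obtain ⟨b, -⟩ := exists_orthonormalBasis_leviDet hν
  obtain ⟨u, hu0, -⟩ := exists_orthonormalBasis_cons hν b
  rw [formDensity_eq A z u hu0, AlternatingMap.smul_apply, boundaryVolForm_tangentFrame A z u hu0,
    smul_eq_mul, mul_one]

end Density

/-! ### Continuity of the Levi determinant and finiteness of the boundary measure -/

section Continuity

variable {m : ℕ} {A U : Set (Cn (m + 1))} {ρ : Cn (m + 1) → ℝ} {z : Cn (m + 1)}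

/-- The component of `v` orthogonal to the unit vector `w`. -/
def perpPart (w v : Cn (m + 1)) : Cn (m + 1) := v - inner ℂ w v • w

theorem perpPart_mem (hν : ‖gaussMap A z‖ = 1) (v : Cn (m + 1)) :
    perpPart (gaussMap A z) v ∈ complexTangentSpace A z := by
  rw [complexTangentSpace, Submodule.mem_orthogonal_singleton_iff_inner_right, perpPart,
    inner_sub_right, inner_smul_right, inner_self_eq_norm_sq_to_K, hν]
  simp

theorem det_block_one (M : Matrix (Fin m) (Fin m) ℂ) :
    (Matrix.of (Fin.cons (Fin.cons 1 0) fun a => Fin.cons 0 (M a)) :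
      Matrix (Fin (m + 1)) (Fin (m + 1)) ℂ).det = M.det := by
  rw [Matrix.det_succ_row_zero, Finset.sum_eq_single 0]
  · simp
    congr 1
  · intro j _ hj
    obtain ⟨j, rfl⟩ := Fin.exists_succ_eq.mpr hj
    simp
  · simp

/-- The standard basis vectors of `ℂⁿ`. -/
def stdVector (j : Fin (m + 1)) : Cn (m + 1) := EuclideanSpace.single j 1

/-- The basis chosen in `leviMatrix` need not vary continuously with `z`. Extending the Levi form to
all of `ℂⁿ` by `1` on the normal keeps the determinant, and in the fixed standard basis the extended
matrix is `X diag(1, M) X*` with `X` unitary. -/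
theorem leviDet_eq_det (hν : ‖gaussMap A z‖ = 1) (hs : IsSymmSecondForm A z) :
    leviDet A z = (Matrix.of fun j k : Fin (m + 1) =>
      inner ℂ (gaussMap A z) (stdVector j) *
        starRingEnd ℂ (inner ℂ (gaussMap A z) (stdVector k)) +
      leviForm A z (perpPart (gaussMap A z) (stdVector j))
        (perpPart (gaussMap A z) (stdVector k))).det.re := by
  obtain ⟨b, hb⟩ := exists_orthonormalBasis_leviDet hν
  obtain ⟨u, hu0, hu⟩ := exists_orthonormalBasis_cons hν b
  let X : Matrix (Fin (m + 1)) (Fin (m + 1)) ℂ := Matrix.of fun j a => inner ℂ (u a) (stdVector j)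
  have hX : X * X.conjTranspose = 1 := by
    ext j k
    rw [Matrix.mul_apply]
    have h1 : ∀ a, X j a * X.conjTranspose a k =
        inner ℂ (stdVector k) (u a) * inner ℂ (u a) (stdVector j) := by
      intro a
      rw [Matrix.conjTranspose_apply, mul_comm]
      simp only [X, Matrix.of_apply]
      rw [← inner_conj_symm (stdVector k) (u a)]
      rfl
    simp only [h1]
    rw [u.sum_inner_mul_inner, Matrix.one_apply]
    simp [stdVector, EuclideanSpace.inner_single_left, eq_comm]
  have hq : ∀ j, perpPart (gaussMap A z) (stdVector j) =
      (∑ a, X j a.succ • b a : complexTangentSpace A z) := by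
    intro j
    have h1 := u.sum_repr' (stdVector j)
    rw [Fin.sum_univ_succ, hu0] at h1
    refine (sub_eq_iff_eq_add'.mpr h1.symm).trans ?_
    simp [X, hu]
  have hG : (Matrix.of fun j k : Fin (m + 1) =>
      inner ℂ (gaussMap A z) (stdVector j) *
        starRingEnd ℂ (inner ℂ (gaussMap A z) (stdVector k)) +
      leviForm A z (perpPart (gaussMap A z) (stdVector j))
        (perpPart (gaussMap A z) (stdVector k))) =
      X * (Matrix.of (Fin.cons (Fin.cons 1 0) fun a => Fin.cons 0 (leviMatrixOf A z b a)) :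
        Matrix (Fin (m + 1)) (Fin (m + 1)) ℂ) * X.conjTranspose := by
    ext j k
    rw [Matrix.of_apply, hq, hq, hs.leviForm_sum, Matrix.mul_apply, Fin.sum_univ_succ]
    simp only [Matrix.mul_apply, Fin.sum_univ_succ, Matrix.of_apply, Fin.cons_zero, Fin.cons_succ,
      Matrix.conjTranspose_apply, Pi.zero_apply, mul_zero, mul_one, add_zero, zero_add,
      Finset.sum_const_zero, Finset.sum_mul]
    rw [Finset.sum_comm]
    simp only [X, Matrix.of_apply, hu0, leviMatrixOf]
    rfl
  rw [hG, Matrix.det_mul, Matrix.det_mul, det_block_one, hb]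
  have hdet := congrArg Matrix.det hX
  rw [Matrix.det_mul, Matrix.det_one] at hdet
  congr 1
  linear_combination -(leviMatrixOf A z b).det * hdet

/-- The Levi form determined by the derivative `D` of a normal field. -/
def leviExpr (D : Cn (m + 1) →L[ℝ] Cn (m + 1)) (ζ η : Cn (m + 1)) : ℂ :=
  (((1 / 2) * (reInner (D ζ) η + reInner (D (Complex.I • ζ)) (Complex.I • η)) : ℝ) : ℂ) +
    Complex.I * (((1 / 2) * (reInner (D ζ) (Complex.I • η) +
      reInner (D (Complex.I • ζ)) (Complex.I • Complex.I • η)) : ℝ) : ℂ)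

theorem IsDefiningFunctionOn.leviForm_eq_leviExpr (hA : IsClosed A)
    (h : IsDefiningFunctionOn A U ρ) (hzU : z ∈ U) (hz : z ∈ frontier A) {ζ : Cn (m + 1)}
    (hζ : ζ ∈ complexTangentSpace A z) (η : Cn (m + 1)) :
    leviForm A z ζ η = leviExpr (fderiv ℝ (normalField ρ) z) ζ η := by
  have m1 := (mem_complexTangentSpace_iff A z _).mp hζ
  simp only [leviForm, secondFormC, secondForm, h.fderivWithin_gaussMap_apply hA hzU hz m1.1,
    h.fderivWithin_gaussMap_apply hA hzU hz m1.2, leviExpr]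

theorem continuousOn_reInner {X : Type*} [TopologicalSpace X] {s : Set X} {f g : X → Cn (m + 1)}
    (hf : ContinuousOn f s) (hg : ContinuousOn g s) :
    ContinuousOn (fun x => reInner (f x) (g x)) s :=
  Complex.continuous_re.comp_continuousOn (ContinuousOn.inner (𝕜 := ℂ) hf hg)

theorem continuousOn_leviExpr {X : Type*} [TopologicalSpace X] {s : Set X}
    {D : X → Cn (m + 1) →L[ℝ] Cn (m + 1)} {f g : X → Cn (m + 1)} (hD : ContinuousOn D s)
    (hf : ContinuousOn f s) (hg : ContinuousOn g s) :
    ContinuousOn (fun x => leviExpr (D x) (f x) (g x)) s := by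
  have hf' : ContinuousOn (fun x => Complex.I • f x) s :=
    (continuousOn_const (c := Complex.I)).smul hf
  have hg' : ContinuousOn (fun x => Complex.I • g x) s :=
    (continuousOn_const (c := Complex.I)).smul hg
  have hg'' : ContinuousOn (fun x => Complex.I • Complex.I • g x) s :=
    (continuousOn_const (c := Complex.I)).smul hg'
  have d1 := hD.clm_apply hf
  have d2 := hD.clm_apply hf'
  refine ContinuousOn.add ?_ (continuousOn_const.mul ?_) <;>
    refine Complex.continuous_ofReal.comp_continuousOn
      (continuousOn_const.mul (ContinuousOn.add ?_ ?_))
  · exact continuousOn_reInner d1 hg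
  · exact continuousOn_reInner d2 hg'
  · exact continuousOn_reInner d1 hg'
  · exact continuousOn_reInner d2 hg''

/-- Since `ρ` is of class `C²`, the normalised gradient is `C¹`; the formula of `leviDet_eq_det` is
continuous in that field and its derivative. -/
theorem IsDefiningFunctionOn.continuousOn_leviDet (hA : IsClosed A)
    (h : IsDefiningFunctionOn A U ρ) : ContinuousOn (leviDet A) (frontier A ∩ U) := by
  let g : Cn (m + 1) → ℝ := fun z => (Matrix.of fun j k : Fin (m + 1) =>
      inner ℂ (normalField ρ z) (stdVector j) *
        starRingEnd ℂ (inner ℂ (normalField ρ z) (stdVector k)) +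
      leviExpr (fderiv ℝ (normalField ρ) z) (perpPart (normalField ρ z) (stdVector j))
        (perpPart (normalField ρ z) (stdVector k))).det.re
  have hg : ContinuousOn g U := by
    have c1 : ContinuousOn (normalField ρ) U := h.contDiffOn_normalField.continuousOn
    have c2 : ContinuousOn (fderiv ℝ (normalField ρ)) U :=
      h.contDiffOn_normalField.continuousOn_fderiv_of_isOpen h.isOpen le_rfl
    have c3 : ∀ j, ContinuousOn (fun z => inner ℂ (normalField ρ z) (stdVector j)) U :=
      fun j => ContinuousOn.inner (𝕜 := ℂ) c1 continuousOn_const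
    have c4 : ∀ j, ContinuousOn (fun z => perpPart (normalField ρ z) (stdVector j)) U :=
      fun j => continuousOn_const.sub ((c3 j).smul c1)
    refine Complex.continuous_re.comp_continuousOn ?_
    rw [continuousOn_iff_continuous_domRestrict]
    refine Continuous.matrix_det ?_
    refine continuous_matrix fun j k => ?_
    have c5 : ContinuousOn (fun z => inner ℂ (normalField ρ z) (stdVector j) *
        starRingEnd ℂ (inner ℂ (normalField ρ z) (stdVector k)) +
      leviExpr (fderiv ℝ (normalField ρ) z) (perpPart (normalField ρ z) (stdVector j))
        (perpPart (normalField ρ z) (stdVector k))) U :=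
      ((c3 j).mul (Complex.continuous_conj.comp_continuousOn (c3 k))).add
        (continuousOn_leviExpr c2 (c4 j) (c4 k))
    exact continuousOn_iff_continuous_domRestrict.mp c5
  refine (hg.mono Set.inter_subset_right).congr fun z hz => ?_
  have hν : ‖gaussMap A z‖ = 1 := (h.isDefiningFunctionAt hA hz.2).norm_gaussMap hz.1
  rw [leviDet_eq_det hν fun ζ hζ η hη => h.secondForm_comm hA hz.2 hz.1 hζ hη]
  simp only [g, ← h.gaussMap_eq hA hz.2 hz.1]
  congr 2
  ext j k
  simp only [Matrix.of_apply]
  rw [h.leviForm_eq_leviExpr hA hz.2 hz.1 (perpPart_mem hν _)]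

theorem IsRegular.continuousOn_leviDet (hA : IsRegular 2 A) :
    ContinuousOn (leviDet A) (frontier A) := by
  intro p hp
  obtain ⟨U, ρ, hpU, h⟩ := hA.exists_isDefiningFunctionOn hp
  exact (continuousWithinAt_inter (h.isOpen.mem_nhds hpU)).mp
    (h.continuousOn_leviDet hA.isCompact.isClosed p ⟨hp, hpU⟩)

theorem IsRegular.measure_frontier_lt_top (hA : IsRegular 2 A) :
    (μHE[2 * (m + 1) - 1] : Measure (Cn (m + 1))) (frontier A) < ⊤ := by
  have hfin : Module.finrank ℝ (Cn (m + 1)) = (2 * (m + 1) - 1) + 1 := by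
    rw [← Module.finrank_mul_finrank ℝ ℂ, Complex.finrank_real_complex, finrank_euclideanSpace_fin]
    omega
  have hc : IsCompact (frontier A) :=
    hA.isCompact.of_isClosed_subset isClosed_frontier hA.isCompact.isClosed.frontier_subset
  refine hc.measure_lt_top_of_nhdsWithin fun p hp => ?_
  obtain ⟨U, ρ, hpU, h⟩ := hA.exists_isDefiningFunctionOn hp
  obtain ⟨W, hW, hlt⟩ := exists_hausdorffMeasure_levelSet_lt_top
    ((h.contDiffOn.contDiffAt (h.isOpen.mem_nhds hpU)).hasStrictFDerivAt two_ne_zero)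
    (h.fderiv_ne_zero p hpU) ((h.eq_zero_iff p hpU).mpr hp) hfin
  refine ⟨frontier A ∩ (U ∩ W), ?_, ?_⟩
  · exact Filter.inter_mem self_mem_nhdsWithin
      (mem_nhdsWithin_of_mem_nhds (Filter.inter_mem (h.isOpen.mem_nhds hpU) hW))
  -- The Euclidean normalisation is a finite multiple of the Hausdorff measure.
  · rw [Measure.euclideanHausdorffMeasure_def, Measure.smul_apply]
    refine ENNReal.mul_lt_top ENNReal.coe_lt_top ((measure_mono ?_).trans_lt hlt)
    exact fun x hx => ⟨hx.2.2, (h.eq_zero_iff x hx.2.1).mpr hx.1⟩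

theorem IsRegular.integrableOn_leviDet (hA : IsRegular 2 A) :
    IntegrableOn (leviDet A) (frontier A) μHE[2 * (m + 1) - 1] := by
  have hc : IsCompact (frontier A) :=
    hA.isCompact.of_isClosed_subset isClosed_frontier hA.isCompact.isClosed.frontier_subset
  obtain ⟨C, hC⟩ := hc.exists_bound_of_continuousOn hA.continuousOn_leviDet
  have : IsFiniteMeasure ((μHE[2 * (m + 1) - 1] : Measure (Cn (m + 1))).restrict (frontier A)) :=
    ⟨by rw [Measure.restrict_apply_univ]; exact hA.measure_frontier_lt_top⟩
  exact Integrable.of_bound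
    (hA.continuousOn_leviDet.aestronglyMeasurable isClosed_frontier.measurableSet) C
    ((ae_restrict_iff' isClosed_frontier.measurableSet).mpr (Filter.Eventually.of_forall hC))

end Continuity

end Pseudovolume
end

/-! ### Integration of the pointwise identity -/

theorem mainTheorem5 (n : ℕ) [NeZero n] (A : Set (Pseudovolume.Cn n))
    (hA : Pseudovolume.IsRegular 2 A) :
    Pseudovolume.FormIntegrable A (Pseudovolume.alphaWedge A) ∧
    Pseudovolume.FormIntegrable A
      (fun z => Pseudovolume.leviDet A z • Pseudovolume.boundaryVolForm A z) ∧
    Pseudovolume.pseudovolume A =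
      2 ^ (n - 1) * ((n - 1).factorial : ℝ) / ((n.factorial : ℝ) * Pseudovolume.ballVolume n) *
        Pseudovolume.formIntegral A
          (fun z => Pseudovolume.leviDet A z • Pseudovolume.boundaryVolForm A z) ∧
    (Pseudovolume.IsPseudoconvex A → 0 ≤ Pseudovolume.pseudovolume A) := by
  obtain ⟨m, rfl⟩ : ∃ m, n = m + 1 := ⟨n - 1, (Nat.succ_pred_eq_of_ne_zero (NeZero.ne n)).symm⟩
  have hAc := hA.isCompact.isClosed
  have hM : MeasurableSet (frontier A) := isClosed_frontier.measurableSet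
  have e1 : ∀ z ∈ frontier A, Pseudovolume.formDensity A z (Pseudovolume.alphaWedge A z) =
      2 ^ m * m.factorial * Pseudovolume.leviDet A z := by
    intro z hz
    obtain ⟨U, ρ, hzU, h⟩ := hA.exists_isDefiningFunctionOn hz
    exact Pseudovolume.formDensity_alphaWedge hAc h hzU hz
  have e2 : ∀ z ∈ frontier A, Pseudovolume.formDensity A z
      (Pseudovolume.leviDet A z • Pseudovolume.boundaryVolForm A z) =
      Pseudovolume.leviDet A z := by
    intro z hz
    obtain ⟨U, ρ, hzU, h⟩ := hA.exists_isDefiningFunctionOn hz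
    exact Pseudovolume.formDensity_smul_boundaryVolForm
      ((h.isDefiningFunctionAt hAc hzU).norm_gaussMap hz) _
  have i1 : Pseudovolume.formIntegral A (Pseudovolume.alphaWedge A) =
      2 ^ m * m.factorial * ∫ z in frontier A, Pseudovolume.leviDet A z ∂μHE[2 * (m + 1) - 1] := by
    rw [Pseudovolume.formIntegral, setIntegral_congr_fun hM e1, integral_const_mul]
  have i2 : Pseudovolume.formIntegral A
      (fun z => Pseudovolume.leviDet A z • Pseudovolume.boundaryVolForm A z) =
      ∫ z in frontier A, Pseudovolume.leviDet A z ∂μHE[2 * (m + 1) - 1] := by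
    rw [Pseudovolume.formIntegral, setIntegral_congr_fun hM e2]
  refine ⟨?_, ?_, ?_, fun hpc => ?_⟩
  · exact IntegrableOn.congr_fun (hA.integrableOn_leviDet.const_mul (2 ^ m * m.factorial))
      (fun z hz => (e1 z hz).symm) hM
  · exact IntegrableOn.congr_fun hA.integrableOn_leviDet (fun z hz => (e2 z hz).symm) hM
  · rw [Pseudovolume.pseudovolume, i1, i2, Nat.add_sub_cancel]
    ring
  · rw [Pseudovolume.pseudovolume, i1]
    have h1 : 0 ≤ ∫ z in frontier A, Pseudovolume.leviDet A z ∂μHE[2 * (m + 1) - 1] := by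
      refine setIntegral_nonneg hM fun z hz => ?_
      obtain ⟨U, ρ, hzU, h⟩ := hA.exists_isDefiningFunctionOn hz
      exact Pseudovolume.IsSymmSecondForm.leviDet_nonneg
        (fun ζ hζ η hη => h.secondForm_comm hAc hzU hz hζ hη) (hpc z hz)
    have h2 : 0 ≤ Pseudovolume.ballVolume (m + 1) := ENNReal.toReal_nonneg
    positivity
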